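/- Let $m\ge 1$, let $M$ be a compact smooth manifold of dimension $2n$ without boundary, $Z\subset M$ a compact embedded hypersurface, and $z$ a local defining function of $Z$ (on a neighbourhood of $Z$ it is smooth and $Z$ is its regular zero level set). A $b^{2m}$-vector field is a smooth vector field $X$ on $M$ with $dz(X)\in z^{2m}C^\infty$ near $Z$. A $b^{2m}$-symplectic form is a symplectic form $\omega$ on $M\setminus Z$ that near each point of $Z$ can be written as $\frac{dz}{z^{2m}}\wedge\mu+\nu$ with $\mu,\nu$ smooth forms, and that is nondegenerate as a $b^{2m}$-form also at the points of $Z$. Let $(z,\pi)$ be a diffeomorphism from a tubular neighbourhood $\{|z|<\delta\}$ of $Z$ onto $(-\delta,\delta)\times Z$ (with $\pi|_Z=\mathrm{id}$) in which $\omega$ has a Laurent decomposition $$\omega=\frac{dz}{z^{2m}}\wedge\sum_{i=0}^{2m-1}z^i\,\pi^*\alpha_i+\pi^*\beta ,$$ with $\alpha_i$ and $\beta$ smooth closed forms on $Z$ of degree $1$ and $2$. Let $X^\sigma=z^{2m}\partial_z$, and let $R$ be the lift to the tubular neighbourhood (with $dz(R)=0$) of the Reeb vector field on $Z$ given by $\alpha_0(R)=1$,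 $\iota_R\beta=0$. Let $H_t$ be a $b^{2m}$-Hamiltonian, $1$-periodic in $t$: it is smooth on $M\setminus Z$, and near each point of $Z$ it has the form $\sum_{i=1}^{2m-1}a_i(t,z)z^{-i}+c(t)\log|z|+h_t$ with $a_i$, $c$, $h$ smooth and $1$-periodic in $t$. Its Hamiltonian vector field $X_H^\omega$ is the time-dependent $b^{2m}$-vector field with $\iota_{X_H^\omega}\omega=-dH_t$ on $M\setminus Z$. Let $0<\rho\le\delta$ and suppose that $H$ is admissible on $\{|z|<\rho\}$, that is: 1. $\mathcal L_{X^\sigma}H_t=k(t)$ on $\{0<|z|<\rho\}$, where $k$ is smooth and $1$-periodic in $t$ and may depend on the connected component of $Z$; 2. $\mathcal L_RH_t=0$ on $\{0<|z|<\rho\}$; 3. $X_H^\omega$ has no $1$-periodic orbit contained in $\{|z|<\rho\}$. Let $f\in C^\infty(\mathbb R)$ be odd with $f'>0$ on $[-1,1]$, $f(x)=-\frac{1}{(2m-1)x^{2m-1}}-2$ for $x<-1$ and $f(x)=-\frac{1}{(2m-1)x^{2m-1}}+2$ for $x>1$. For $0<\varepsilon<\rho$ put $f_\varepsilon(x)=\varepsilon^{-(2m-1)}f(x/\varepsilon)$,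 and let the desingularization $\omega_\varepsilon$ be the $2$-form $$\omega_\varepsilon=d f_\varepsilon(z)\wedge\sum_{i=0}^{2m-1}z^i\,\pi^*\alpha_i+\pi^*\beta\quad\text{on }\{|z|<\varepsilon\},\qquad \omega_\varepsilon=\omega\quad\text{elsewhere}.$$ Then $\omega_\varepsilon$ is a symplectic form on $M$, the Hamiltonian vector field $X_H^\omega$ exists and is unique, and it is a symplectic vector field for $\omega_\varepsilon$: for every $t$ it is a smooth vector field on $M$ with $\mathcal L_{X_{H_t}^\omega}\omega_\varepsilon=0$. -/

import Mathlib

open Set Manifold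
open scoped ContDiff Topology

noncomputable section

namespace BSymp

/-! ### Differential forms and vector fields on manifolds without boundary -/

section Forms

/-- A (not necessarily smooth) differential `k`-form on `M`. -/
abbrev DiffForm (E : Type*) [NormedAddCommGroup E] [NormedSpace ℝ E]
    (M : Type*) [TopologicalSpace M] [ChartedSpace E M] (k : ℕ) : Type _ :=
  ∀ p : M, (TangentSpace 𝓘(ℝ, E) p) [⋀^Fin k]→L[ℝ] ℝ

/-- A (not necessarily smooth) vector field on `M`. -/
abbrev VField (E : Type*) [NormedAddCommGroup E] [NormedSpace ℝ E]
    (M : Type*) [TopologicalSpace M] [ChartedSpace E M] : Type _ :=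
  ∀ p : M, TangentSpace 𝓘(ℝ, E) p

variable {E : Type*} [NormedAddCommGroup E] [NormedSpace ℝ E]
  {M : Type*} [TopologicalSpace M] [ChartedSpace E M] {k : ℕ}

/-- The derivative of the chart at `p`, at the point `p`. -/
def dChart (E : Type*) [NormedAddCommGroup E] [NormedSpace ℝ E]
    {M : Type*} [TopologicalSpace M] [ChartedSpace E M] (p : M) : E →L[ℝ] E :=
  mfderiv 𝓘(ℝ, E) 𝓘(ℝ, E) (extChartAt 𝓘(ℝ, E) p) p

/-- The derivative at `y` of the inverse of the chart at `p`. -/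
def dChartSymm (p : M) (y : E) : E →L[ℝ] E :=
  mfderiv 𝓘(ℝ, E) 𝓘(ℝ, E) (extChartAt 𝓘(ℝ, E) p).symm y

/-- The form `Ω` written in the chart at `p`: its pullback to the model space under the inverse of
that chart. -/
def chartRep (Ω : DiffForm E M k) (p : M) : E → E [⋀^Fin k]→L[ℝ] ℝ := fun y =>
  ContinuousAlternatingMap.compContinuousLinearMap
    (Ω ((extChartAt 𝓘(ℝ, E) p).symm y) : E [⋀^Fin k]→L[ℝ] ℝ) (dChartSymm p y)

/-- The vector field `X` written in the chart at `p`: its pullback under the inverse of that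
chart. -/
def chartRepVF (X : VField E M) (p : M) : E → E := fun y =>
  (dChartSymm p y).inverse (X ((extChartAt 𝓘(ℝ, E) p).symm y) : E)

/-- The form `Ω` is smooth at `p`. -/
def SmoothFormAt (Ω : DiffForm E M k) (p : M) : Prop :=
  ContDiffAt ℝ ∞ (chartRep Ω p) (extChartAt 𝓘(ℝ, E) p p)

/-- The vector field `X` is smooth on `M`. -/
def SmoothVF [IsManifold 𝓘(ℝ, E) ∞ M] (X : VField E M) : Prop :=
  ContMDiff 𝓘(ℝ, E) 𝓘(ℝ, E).tangent ∞ (fun p => (⟨p, X p⟩ : TangentBundle 𝓘(ℝ, E) M))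

/-- The exterior derivative of a form, computed at `p` in the chart at `p`. -/
def extD (Ω : DiffForm E M k) : DiffForm E M (k + 1) := fun p =>
  ((extDeriv (chartRep Ω p) (extChartAt 𝓘(ℝ, E) p p)).compContinuousLinearMap (dChart E p) :
    E [⋀^Fin (k + 1)]→L[ℝ] ℝ)

/-- The Lie derivative of a form along a vector field, by its local coordinate expression
`(L_X Ω)(v₁, …, vₖ) = (D_X Ω)(v₁, …, vₖ) + ∑ᵢ Ω(v₁, …, DX(vᵢ), …, vₖ)`,
computed at `p` in the chart at `p`. -/
def lieD (X : VField E M) (Ω : DiffForm E M k) (p : M)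
    (v : Fin k → TangentSpace 𝓘(ℝ, E) p) : ℝ :=
  let y : E := extChartAt 𝓘(ℝ, E) p p
  let w : Fin k → E := fun i => dChart E p (v i)
  fderiv ℝ (chartRep Ω p) y (chartRepVF X p y) w +
    ∑ i, chartRep Ω p y (Function.update w i (fderiv ℝ (chartRepVF X p) y (w i)))

/-- The 2-form `Ω` is nondegenerate at `p`. -/
def NondegAt (Ω : DiffForm E M 2) (p : M) : Prop :=
  ∀ u : TangentSpace 𝓘(ℝ, E) p, (∀ v : TangentSpace 𝓘(ℝ, E) p, Ω p ![u, v] = 0) → u = 0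

/-- A symplectic form: smooth, closed and nondegenerate. -/
structure IsSymplecticForm (Ω : DiffForm E M 2) : Prop where
  smooth : ∀ p, SmoothFormAt Ω p
  closed : ∀ p, extD Ω p = 0
  nondeg : ∀ p, NondegAt Ω p

/-- A symplectic vector field for `Ω`: a smooth vector field with `L_X Ω = 0`. -/
def IsSymplecticVF [IsManifold 𝓘(ℝ, E) ∞ M] (Ω : DiffForm E M 2) (X : VField E M) : Prop :=
  SmoothVF X ∧ ∀ p v, lieD X Ω p v = 0

/-- The differential of a function at a point. -/
def dAt (f : M → ℝ) (p : M) : TangentSpace 𝓘(ℝ, E) p →L[ℝ] ℝ :=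
  mfderiv 𝓘(ℝ, E) 𝓘(ℝ, ℝ) f p

/-- The wedge product `a ∧ b` of two covectors, see `wedge_apply`. -/
def wedge {V : Type*} [AddCommGroup V] [Module ℝ V] [TopologicalSpace V] [IsTopologicalAddGroup V]
    [ContinuousSMul ℝ V] (a b : V →L[ℝ] ℝ) : V [⋀^Fin 2]→L[ℝ] ℝ :=
  ContinuousMultilinearMap.alternatization
    ((ContinuousMultilinearMap.mkPiAlgebra ℝ (Fin 2) ℝ).compContinuousLinearMap ![a, b])

theorem wedge_apply {V : Type*} [AddCommGroup V] [Module ℝ V] [TopologicalSpace V]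
    [IsTopologicalAddGroup V] [ContinuousSMul ℝ V] (a b : V →L[ℝ] ℝ) (v : Fin 2 → V) :
    wedge a b v = a (v 0) * b (v 1) - a (v 1) * b (v 0) := by
  have h : (Finset.univ : Finset (Equiv.Perm (Fin 2))) = {1, Equiv.swap 0 1} := by decide
  simp [wedge, ContinuousMultilinearMap.alternatization_apply_apply, Fin.prod_univ_two, h,
    Finset.sum_pair (show (1 : Equiv.Perm (Fin 2)) ≠ Equiv.swap 0 1 by decide), sub_eq_add_neg]

/-- A 1-form at a point as a covector. -/
def covec {V : Type*} [AddCommGroup V] [Module ℝ V] [TopologicalSpace V]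
    (a : V [⋀^Fin 1]→L[ℝ] ℝ) : V →L[ℝ] ℝ :=
  (ContinuousAlternatingMap.ofSubsingleton ℝ V ℝ (0 : Fin 1)).symm a

theorem covec_apply {V : Type*} [AddCommGroup V] [Module ℝ V] [TopologicalSpace V]
    (a : V [⋀^Fin 1]→L[ℝ] ℝ) (v : V) : covec a v = a ![v] := by
  simp [covec]
  congr 1
  ext i
  fin_cases i
  rfl

end Forms

/-! ### `b^m`-manifolds and `b^m`-symplectic forms -/

section BGeometry

variable {E : Type*} [NormedAddCommGroup E] [NormedSpace ℝ E]
  {M : Type*} [TopologicalSpace M] [ChartedSpace E M]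

/-- `z` is a local defining function of the hypersurface `Z`: on an open neighbourhood `U` of `Z`
it is smooth, and `Z` is its regular zero level set in `U`. Values of `z` outside `U` are
irrelevant. -/
def IsLocalDefiningFunction (E : Type*) [NormedAddCommGroup E] [NormedSpace ℝ E]
    {M : Type*} [TopologicalSpace M] [ChartedSpace E M] (Z : Set M) (z : M → ℝ) : Prop :=
  ∃ U : Set M, IsOpen U ∧ Z ⊆ U ∧ ContMDiffOn 𝓘(ℝ, E) 𝓘(ℝ, ℝ) ∞ z U ∧
    (∀ p ∈ U, z p = 0 ↔ p ∈ Z) ∧ ∀ p ∈ Z, dAt (E := E) z p ≠ 0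

/-- A `b^m`-vector field: a smooth vector field tangent to order `m` to `Z`, that is
`dz(X) = z^m g` near `Z` with `g` smooth. -/
def IsBVectorField [IsManifold 𝓘(ℝ, E) ∞ M] (m : ℕ) (Z : Set M) (z : M → ℝ)
    (X : VField E M) : Prop :=
  SmoothVF X ∧ ∀ p ∈ Z, ∃ U : Set M, IsOpen U ∧ p ∈ U ∧ ∃ g : M → ℝ,
    ContMDiffOn 𝓘(ℝ, E) 𝓘(ℝ, ℝ) ∞ g U ∧ ∀ q ∈ U, dAt z q (X q) = z q ^ m * g q

/-- A `b^m`-symplectic form on `(M, Z)`. Off `Z` it is a symplectic form. Near each point of `Z`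
it is a `b^m`-form `(dz / z^m) ∧ μ + ν` with `μ`, `ν` smooth, and at the points of `Z` it is
nondegenerate on the `b^m`-tangent space, which is `ℝ · (z^m ∂_z) ⊕ ker dz` and on which
`dz / z^m` is the projection to the first factor. Values of `Ω` at points of `Z` are irrelevant. -/
structure IsBSymplectic (m : ℕ) (Z : Set M) (z : M → ℝ) (Ω : DiffForm E M 2) : Prop where
  smooth : ∀ p ∉ Z, SmoothFormAt Ω p
  closed : ∀ p ∉ Z, extD Ω p = 0
  nondeg : ∀ p ∉ Z, NondegAt Ω p
  near : ∀ p ∈ Z, ∃ U : Set M, IsOpen U ∧ p ∈ U ∧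
    ∃ (μ : DiffForm E M 1) (ν : DiffForm E M 2),
      (∀ q ∈ U, SmoothFormAt μ q ∧ SmoothFormAt ν q) ∧
      (∀ q ∈ U, q ∉ Z → Ω q = (z q ^ m)⁻¹ • wedge (dAt z q) (covec (μ q)) + ν q) ∧
      ∀ (a : ℝ) (u : TangentSpace 𝓘(ℝ, E) p), dAt z p u = 0 →
        (∀ (b : ℝ) (v : TangentSpace 𝓘(ℝ, E) p), dAt z p v = 0 →
          a * covec (μ p) v - b * covec (μ p) u + ν p ![u, v] = 0) → a = 0 ∧ u = 0

/-- A time-dependent (1-periodic in time) `b^m`-function on `(M, Z)`: it is smooth off `Z`, and near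
each point of `Z` it is `∑_{i=1}^{m-1} aᵢ(t, z) z^{-i} + k(t) log |z| + h` with `aᵢ`, `k`, `h`
smooth and 1-periodic in `t`. Values of `H` at points of `Z` are irrelevant. -/
structure IsBFunction (E : Type*) [NormedAddCommGroup E] [NormedSpace ℝ E]
    {M : Type*} [TopologicalSpace M] [ChartedSpace E M] (m : ℕ) (Z : Set M) (z : M → ℝ)
    (H : ℝ → M → ℝ) : Prop where
  periodic : ∀ t, ∀ p ∉ Z, H (t + 1) p = H t p
  smooth : ContMDiffOn (𝓘(ℝ, ℝ).prod 𝓘(ℝ, E)) 𝓘(ℝ, ℝ) ∞ (fun q : ℝ × M => H q.1 q.2)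
    (univ ×ˢ Zᶜ)
  near : ∀ p ∈ Z, ∃ U : Set M, IsOpen U ∧ p ∈ U ∧
    ∃ (a : ℕ → ℝ → ℝ → ℝ) (k : ℝ → ℝ) (h : ℝ → M → ℝ),
      (∀ i, ContDiff ℝ ∞ (fun x : ℝ × ℝ => a i x.1 x.2)) ∧
      (∀ i t x, a i (t + 1) x = a i t x) ∧
      ContDiff ℝ ∞ k ∧ (∀ t, k (t + 1) = k t) ∧
      ContMDiffOn (𝓘(ℝ, ℝ).prod 𝓘(ℝ, E)) 𝓘(ℝ, ℝ) ∞ (fun q : ℝ × M => h q.1 q.2) (univ ×ˢ U) ∧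
      (∀ t, ∀ q ∈ U, h (t + 1) q = h t q) ∧
      ∀ t, ∀ q ∈ U, q ∉ Z → H t q =
        ∑ i ∈ Finset.Icc 1 (m - 1), a i t (z q) / z q ^ i + k t * Real.log |z q| + h t q

/-- `X` is the `b^m`-Hamiltonian vector field of `H` with respect to `Ω`: for every time `t`, `X t`
is a `b^m`-vector field and `ι_X Ω = -dH` off `Z`. -/
def IsHamiltonianVF [IsManifold 𝓘(ℝ, E) ∞ M] (m : ℕ) (Z : Set M) (z : M → ℝ)
    (Ω : DiffForm E M 2) (H : ℝ → M → ℝ) (X : ℝ → VField E M) : Prop :=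
  ∀ t, IsBVectorField m Z z (X t) ∧
    ∀ p ∉ Z, ∀ v : TangentSpace 𝓘(ℝ, E) p, Ω p ![X t p, v] = - dAt (H t) p v

/-- A 1-periodic orbit of a time-dependent vector field. -/
def IsOnePeriodicOrbit (X : ℝ → VField E M) (γ : ℝ → M) : Prop :=
  (∀ t, γ (t + 1) = γ t) ∧
    ∀ t, HasMFDerivAt 𝓘(ℝ, ℝ) 𝓘(ℝ, E) γ t ((1 : ℝ →L[ℝ] ℝ).smulRight (X t (γ t)))

end BGeometry

/-! ### Tubular neighbourhoods, Laurent decomposition, admissibility, desingularization -/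

section Tubular

variable {E : Type*} [NormedAddCommGroup E] [NormedSpace ℝ E]
  {M : Type*} [TopologicalSpace M] [ChartedSpace E M]
  {F : Type*} [NormedAddCommGroup F] [NormedSpace ℝ F]
  {S : Type*} [TopologicalSpace S] [ChartedSpace F S]

/-- A tubular neighbourhood of the hypersurface `Z = range ι`, compatible with the local defining
function `z`: a diffeomorphism `Ψ` from `(-δ, δ) × S` onto an open subset of `M` whose first
coordinate is `z` and which is `ι` on `{0} × S`. The projection `π` to `Z` is the second
coordinate. -/
structure TubularNhd (E F : Type*) [NormedAddCommGroup E] [NormedSpace ℝ E]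
    [NormedAddCommGroup F] [NormedSpace ℝ F]
    {M : Type*} [TopologicalSpace M] [ChartedSpace E M]
    {S : Type*} [TopologicalSpace S] [ChartedSpace F S] (ι : S → M) (z : M → ℝ) where
  δ : ℝ
  δ_pos : 0 < δ
  Ψ : ℝ × S → M
  isLocalDiffeomorphOn : IsLocalDiffeomorphOn (𝓘(ℝ, ℝ).prod 𝓘(ℝ, F)) 𝓘(ℝ, E) ∞ Ψ
    (Ioo (-δ) δ ×ˢ univ)
  injOn : InjOn Ψ (Ioo (-δ) δ ×ˢ univ)
  zero_section : ∀ s, Ψ (0, s) = ι s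
  z_Ψ : ∀ r ∈ Ioo (-δ) δ, ∀ s, z (Ψ (r, s)) = r

namespace TubularNhd

variable {ι : S → M} {z : M → ℝ} (T : TubularNhd E F ι z)

/-- The part `{|z| < ε}` of the tubular neighbourhood. -/
def nhd (ε : ℝ) : Set M := T.Ψ '' (Ioo (-ε) ε ×ˢ univ)

/-- The derivative of `Ψ`. -/
def dΨ (q : ℝ × S) : (ℝ × F) →L[ℝ] E :=
  mfderiv (𝓘(ℝ, ℝ).prod 𝓘(ℝ, F)) 𝓘(ℝ, E) T.Ψ q

end TubularNhd

/-- The 2-form `φ(r) dr ∧ (∑_{i<m} r^i αᵢ) + β` on `ℝ × S` at `(r, s)`. -/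
def modelForm (m : ℕ) (α : ℕ → DiffForm F S 1) (β : DiffForm F S 2) (φ : ℝ → ℝ) (q : ℝ × S) :
    (ℝ × F) [⋀^Fin 2]→L[ℝ] ℝ :=
  φ q.1 • wedge (ContinuousLinearMap.fst ℝ ℝ F)
      ((∑ i ∈ Finset.range m, q.1 ^ i • (covec (α i q.2) : F →L[ℝ] ℝ)).comp
        (ContinuousLinearMap.snd ℝ ℝ F)) +
    ContinuousAlternatingMap.compContinuousLinearMap (β q.2 : F [⋀^Fin 2]→L[ℝ] ℝ)
      (ContinuousLinearMap.snd ℝ ℝ F)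

/-- The Laurent decomposition of `Ω` in the tubular neighbourhood:
`Ω = (dz / z^m) ∧ ∑_{i=0}^{m-1} z^i π^*αᵢ + π^*β`, with `αᵢ` and `β` smooth closed forms on `Z`. -/
structure IsDecomposition {ι : S → M} {z : M → ℝ} (T : TubularNhd E F ι z) (m : ℕ)
    (Ω : DiffForm E M 2) (α : ℕ → DiffForm F S 1) (β : DiffForm F S 2) : Prop where
  smooth_α : ∀ i < m, ∀ s, SmoothFormAt (α i) s
  closed_α : ∀ i < m, ∀ s, extD (α i) s = 0
  smooth_β : ∀ s, SmoothFormAt β s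
  closed_β : ∀ s, extD β s = 0
  eq : ∀ r ∈ Ioo (-T.δ) T.δ, r ≠ 0 → ∀ s,
    ContinuousAlternatingMap.compContinuousLinearMap (Ω (T.Ψ (r, s)) : E [⋀^Fin 2]→L[ℝ] ℝ)
      (T.dΨ (r, s)) = modelForm m α β (fun x => (x ^ m)⁻¹) (r, s)

/-- `R` is the value at `s` of the Reeb vector field of `(α, β)`: `α(R) = 1`, `ι_R β = 0`. -/
def IsReebAt (α : DiffForm F S 1) (β : DiffForm F S 2) (s : S) (R : TangentSpace 𝓘(ℝ, F) s) :
    Prop :=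
  covec (α s) R = 1 ∧ ∀ v : TangentSpace 𝓘(ℝ, F) s, β s ![R, v] = 0

/-- `H` is an admissible `b^m`-Hamiltonian, with the conditions near `Z` valid on `{|z| < ρ}`.
Here `X^σ = z^m ∂_z`, and `R` is the lift by the tubular coordinates of the Reeb vector field of
`(α₀, β)`, where `α₀` is the coefficient of `dz / z^m`.
* `linear`: `L_{X^σ} H_t = k(t)`, where `k` may depend on the connected component of `Z`;
* `reeb`: `L_R H_t = 0`;
* `no_orbits`: the Hamiltonian vector field has no 1-periodic orbit in `{|z| < ρ}`. -/
structure IsAdmissible [IsManifold 𝓘(ℝ, E) ∞ M] {ι : S → M} {z : M → ℝ} (T : TubularNhd E F ι z)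
    (m : ℕ) (Ω : DiffForm E M 2) (α : ℕ → DiffForm F S 1) (β : DiffForm F S 2) (ρ : ℝ)
    (H : ℝ → M → ℝ) : Prop where
  isBFunction : IsBFunction E m (range ι) z H
  linear : ∃ k : S → ℝ → ℝ, (∀ t, IsLocallyConstant (fun s => k s t)) ∧
    (∀ s, ContDiff ℝ ∞ (k s)) ∧ (∀ s t, k s (t + 1) = k s t) ∧
    ∀ t, ∀ r ∈ Ioo (-ρ) ρ, r ≠ 0 → ∀ s,
      dAt (H t) (T.Ψ (r, s)) (T.dΨ (r, s) (r ^ m, 0)) = k s t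
  reeb : ∀ t, ∀ r ∈ Ioo (-ρ) ρ, r ≠ 0 → ∀ s R, IsReebAt (α 0) β s R →
    dAt (H t) (T.Ψ (r, s)) (T.dΨ (r, s) (0, R)) = 0
  no_orbits : ∀ X, IsHamiltonianVF m (range ι) z Ω H X →
    ¬ ∃ γ, IsOnePeriodicOrbit X γ ∧ ∀ t, γ t ∈ T.nhd ρ

/-- The functions `f` used to desingularize `b^{2m}`-symplectic forms. -/
structure IsDesingFunction (m : ℕ) (f : ℝ → ℝ) : Prop where
  smooth : ContDiff ℝ ∞ f
  odd : ∀ x, f (-x) = - f x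
  deriv_pos : ∀ x ∈ Icc (-1 : ℝ) 1, 0 < deriv f x
  left : ∀ x < -1, f x = -1 / ((2 * m - 1) * x ^ (2 * m - 1)) - 2
  right : ∀ x > 1, f x = -1 / ((2 * m - 1) * x ^ (2 * m - 1)) + 2

/-- `f_ε(x) = ε^{-(2m-1)} f(x / ε)`. -/
def fEps (m : ℕ) (f : ℝ → ℝ) (ε : ℝ) (x : ℝ) : ℝ := (ε ^ (2 * m - 1))⁻¹ * f (x / ε)

open Classical in
/-- The `f_ε`-desingularization of `Ω`: it is
`d f_ε(z) ∧ ∑_{i=0}^{2m-1} z^i π^*αᵢ + π^*β` on `{|z| < ε}`, and `Ω` elsewhere. -/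
def desing {ι : S → M} {z : M → ℝ} (T : TubularNhd E F ι z) (m : ℕ) (Ω : DiffForm E M 2)
    (α : ℕ → DiffForm F S 1) (β : DiffForm F S 2) (f : ℝ → ℝ) (ε : ℝ) : DiffForm E M 2 := fun p =>
  if h : ∃ q ∈ Ioo (-ε) ε ×ˢ (univ : Set S), T.Ψ q = p then
    ((modelForm (2 * m) α β (deriv (fEps m f ε)) h.choose).compContinuousLinearMap
      (T.dΨ h.choose).inverse : E [⋀^Fin 2]→L[ℝ] ℝ)
  else Ω p

end Tubular

end BSymp

end

/-! In the tube put `A_r = ∑ r^i α_i`. There `Ω` is `φ(r) dr ∧ A_r + β` with `φ = r^{-2m}`, and the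
desingularization has the same shape with `φ = f_ε' > 0`, because `f_ε'(r) = r^{-2m}` for `|r| ≥ ε`
(`desing_apply`).

Symplectic form: it is closed because `φ` depends on `r` alone and all `α_i`, `β` are closed
(`extDeriv_model`). Nondegeneracy of `φ dr ∧ A_r + β` is the same condition for every nonzero value
of `φ` (`modelNondeg_iff`). For `r ≠ 0` it comes from that of `Ω`; at `r = 0` it is the
nondegeneracy of `Ω` as a `b`-form, reached by a limit `r → 0` (`modelNondeg_zero`).

Hamiltonian field: admissibility gives `dH = k r^{-2m} dr + g` off `Z`, where the tangential part
`g` does not depend on `r`. On one side of `Z` this holds since the radial derivative of `H` is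
locally constant in `s`; the two sides agree since the singular part of `H` is a function of `z` and
`t` only (`TubularNhd.exists_tangential`). Moreover `g(R) = 0`. The solution `u` of `ι_u(φ dr ∧ A_r
+ β) = -(φ k dr + g)` is then tangent to the levels of `r` and satisfies `A_r(u) = k`, `ι_u β = -g`
(`modelForm_hamiltonian`). These equations do not contain `φ`, so one field serves `Ω` and the
desingularization (`exists_hamiltonian`).

For the desingularization this field has the smooth local Hamiltonian `k f_ε(z) + H(ρ/2, ·)` in the
tube and `H` away from it (`isLocallyHamiltonianAt_desing`). Nondegeneracy then makes the field
smooth across `Z`, and Cartan's formula makes it symplectic. It is a `b`-field because `dz(X) = 0`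
near `Z`, and it is unique because its values off `Z` are determined by `Ω` and `Z` has dense
complement. -/

noncomputable section

namespace BSymp

/-! ### Linear algebra of 2-forms, and smoothness and closedness in components -/

section LinearAlgebra

variable {E : Type*} [NormedAddCommGroup E] [NormedSpace ℝ E]

/-- A 2-form as a bilinear form. -/
def pairing (E : Type*) [NormedAddCommGroup E] [NormedSpace ℝ E] :
    (E [⋀^Fin 2]→L[ℝ] ℝ) →L[ℝ] E →L[ℝ] E →L[ℝ] ℝ :=
  (ContinuousLinearMap.compL ℝ E (E [⋀^Fin 1]→L[ℝ] ℝ) (E →L[ℝ] ℝ)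
    (ContinuousAlternatingMap.ofSubsingletonLIE (𝕜 := ℝ) (E := E) (F := ℝ) (0 : Fin 1)).symm).comp
    (ContinuousAlternatingMap.curryLeftLI (𝕜 := ℝ) (E := E) (F := ℝ)
      (n := 1)).toContinuousLinearMap

@[simp] theorem pairing_apply (a : E [⋀^Fin 2]→L[ℝ] ℝ) (u v : E) : pairing E a u v = a ![u, v] := by
  change a.curryLeft u (fun _ => v) = a ![u, v]
  rw [ContinuousAlternatingMap.curryLeft_apply_apply]
  congr 1
  ext i
  fin_cases i <;> rfl

theorem contDiff_pairing {n : WithTop ℕ∞} : ContDiff ℝ n (pairing E) := by fun_prop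

theorem pairing_injective : Function.Injective (pairing E) := by
  intro a b h
  ext v
  have h1 := congrArg (fun c => c (v 0) (v 1)) h
  have h2 : v = ![v 0, v 1] := by
    ext i
    fin_cases i <;> rfl
  simp only [pairing_apply] at h1
  rwa [← h2] at h1

theorem form_swap (a : E [⋀^Fin 2]→L[ℝ] ℝ) (u v : E) : a ![u, v] = - a ![v, u] := by
  have := a.toAlternatingMap.map_swap ![v, u] (show (0 : Fin 2) ≠ 1 by decide)
  change a.toAlternatingMap _ = - a.toAlternatingMap _
  rw [← this]
  congr 1
  ext i
  fin_cases i <;> rfl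

theorem comp_pair {V W : Type*} [AddCommGroup V] [Module ℝ V] [TopologicalSpace V] [AddCommGroup W]
    [Module ℝ W] [TopologicalSpace W]
    (a : W [⋀^Fin 2]→L[ℝ] ℝ) (A : V →L[ℝ] W) (u v : V) :
    a.compContinuousLinearMap A ![u, v] = a ![A u, A v] := by
  rw [ContinuousAlternatingMap.compContinuousLinearMap_apply]
  congr 1
  ext i
  fin_cases i <;> rfl

theorem exists_clm_leftInverse {V W : Type*} [NormedAddCommGroup V] [NormedSpace ℝ V]
    [NormedAddCommGroup W] [NormedSpace ℝ W] [FiniteDimensional ℝ W] (p : V →L[ℝ] W)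
    (hp : Function.Injective p) : ∃ g : W →L[ℝ] V, ∀ v, g (p v) = v := by
  obtain ⟨g, hg⟩ := p.toLinearMap.exists_leftInverse_of_injective (LinearMap.ker_eq_bot.2 hp)
  exact ⟨LinearMap.toContinuousLinearMap g, fun v => LinearMap.congr_fun hg v⟩

variable [FiniteDimensional ℝ E]
  {G : Type*} [NormedAddCommGroup G] [NormedSpace ℝ G]

/-- A basis identifies `E →L[ℝ] K` with a finite power of `K`, whose coordinates are the values at
the basis vectors. -/
theorem contDiffAt_clm_apply_iff {K : Type*} [NormedAddCommGroup K] [NormedSpace ℝ K]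
    {f : G → E →L[ℝ] K} {x : G} {n : WithTop ℕ∞} :
    ContDiffAt ℝ n f x ↔ ∀ u, ContDiffAt ℝ n (fun y => f y u) x := by
  refine ⟨fun h u => h.clm_apply contDiffAt_const, fun h => ?_⟩
  let d := Module.finrank ℝ E
  have hd : d = Module.finrank ℝ (Fin d → ℝ) := (Module.finrank_fin_fun ℝ).symm
  let e₁ := ContinuousLinearEquiv.ofFinrankEq hd
  let e₂ := (e₁.arrowCongr (1 : K ≃L[ℝ] K)).trans (ContinuousLinearEquiv.piRing (Fin d))
  rw [← Function.id_comp f, ← e₂.symm_comp_self]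
  exact e₂.symm.contDiff.contDiffAt.comp x (contDiffAt_pi.mpr fun i => h _)

/-- `pairing E` is an injective linear map into a finite-dimensional space, so it has a continuous
left inverse, and smoothness can be tested on the bilinear form. -/
theorem contDiffAt_form_iff {η : G → E [⋀^Fin 2]→L[ℝ] ℝ} {x : G} {n : WithTop ℕ∞} :
    ContDiffAt ℝ n η x ↔ ∀ u v, ContDiffAt ℝ n (fun y => η y ![u, v]) x := by
  constructor
  · intro h u v
    have h1 : ContDiffAt ℝ n (fun y => pairing E (η y)) x :=
      contDiff_pairing.contDiffAt.comp x h
    have := (h1.clm_apply (contDiffAt_const (c := u))).clm_apply (contDiffAt_const (c := v))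
    simpa using this
  · intro h
    have h1 : ContDiffAt ℝ n (fun y => pairing E (η y)) x := by
      rw [contDiffAt_clm_apply_iff]
      intro u
      rw [contDiffAt_clm_apply_iff]
      intro v
      simpa using h u v
    obtain ⟨g, hg⟩ := exists_clm_leftInverse (V := E [⋀^Fin 2]→L[ℝ] ℝ)
      (W := E →L[ℝ] E →L[ℝ] ℝ) (pairing E) pairing_injective
    have h2 : η = fun y => g (pairing E (η y)) := by
      ext1 y
      exact (hg (η y)).symm
    rw [h2]
    exact g.contDiff.contDiffAt.comp x h1

/-- A nondegenerate 2-form on a finite-dimensional space is an isomorphism to the dual space. -/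
theorem pairing_isInvertible {a : E [⋀^Fin 2]→L[ℝ] ℝ}
    (ha : ∀ u, (∀ v, a ![u, v] = 0) → u = 0) : (pairing E a).IsInvertible := by
  have hinj : Function.Injective (pairing E a) := by
    rw [injective_iff_map_eq_zero]
    intro u hu
    refine ha u fun v => ?_
    rw [← pairing_apply, hu]
    rfl
  have hdim : Module.finrank ℝ E = Module.finrank ℝ (E →L[ℝ] ℝ) := by
    rw [← (LinearMap.toContinuousLinearMap (𝕜 := ℝ) (E := E) (F' := ℝ)).finrank_eq]
    exact Subspace.dual_finrank_eq.symm
  let e := LinearEquiv.ofInjectiveOfFinrankEq (pairing E a).toLinearMap hinj hdim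
  exact ⟨e.toContinuousLinearEquiv, by ext u v; rfl⟩

theorem contDiffAt_pullback {E : Type*} [NormedAddCommGroup E] [NormedSpace ℝ E]
    {K : Type*} [NormedAddCommGroup K] [NormedSpace ℝ K]
    [FiniteDimensional ℝ K]
    {η : E → E [⋀^Fin 2]→L[ℝ] ℝ} {f : K → E} {x : K}
    (hη : ContDiffAt ℝ ∞ η (f x)) (hf : ContDiffAt ℝ ∞ f x) :
    ContDiffAt ℝ ∞ (fun y => (η (f y)).compContinuousLinearMap (fderiv ℝ f y)) x := by
  rw [contDiffAt_form_iff]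
  intro u v
  have h1 : ContDiffAt ℝ ∞ (fun y => pairing E (η (f y))) x :=
    contDiff_pairing.contDiffAt.comp x (hη.comp x hf)
  have h2 : ContDiffAt ℝ ∞ (fderiv ℝ f) x := hf.fderiv_right (by simp)
  have := (h1.clm_apply (h2.clm_apply (contDiffAt_const (c := u)))).clm_apply
    (h2.clm_apply (contDiffAt_const (c := v)))
  simpa only [pairing_apply, comp_pair] using this

omit [FiniteDimensional ℝ E] in
/-- The closedness of a 2-form in terms of the derivatives of its components. -/
theorem extDeriv_two_eq_zero_iff {η : E → E [⋀^Fin 2]→L[ℝ] ℝ} {x : E}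
    (hη : DifferentiableAt ℝ η x) :
    extDeriv η x = 0 ↔ ∀ a b c, fderiv ℝ (fun y => η y ![b, c]) x a -
      fderiv ℝ (fun y => η y ![a, c]) x b + fderiv ℝ (fun y => η y ![a, b]) x c = 0 := by
  have key : ∀ a b c, extDeriv η x ![a, b, c] = fderiv ℝ (fun y => η y ![b, c]) x a -
      fderiv ℝ (fun y => η y ![a, c]) x b + fderiv ℝ (fun y => η y ![a, b]) x c := by
    intro a b c
    have h1 := (extDeriv_apply hη ![a, b, c]).trans (Fin.sum_univ_three _)
    have e0 : (0 : Fin 3).removeNth ![a, b, c] = ![b, c] := by ext i; fin_cases i <;> rfl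
    have e1 : (1 : Fin 3).removeNth ![a, b, c] = ![a, c] := by ext i; fin_cases i <;> rfl
    have e2 : (2 : Fin 3).removeNth ![a, b, c] = ![a, b] := by ext i; fin_cases i <;> rfl
    rw [e0, e1, e2] at h1
    change _ = (-1) ^ 0 • fderiv ℝ (fun y => η y ![b, c]) x a +
      (-1) ^ 1 • fderiv ℝ (fun y => η y ![a, c]) x b +
      (-1) ^ 2 • fderiv ℝ (fun y => η y ![a, b]) x c at h1
    norm_num at h1
    rw [h1]
    ring
  constructor
  · intro h a b c
    rw [← key, h]
    rfl
  · intro h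
    ext v
    have hv : v = ![v 0, v 1, v 2] := by ext i; fin_cases i <;> rfl
    rw [hv, key, h]
    rfl

end LinearAlgebra

/-! ### Forms, vector fields and local Hamiltonians in charts -/

section Charts

variable {E : Type*} [NormedAddCommGroup E] [NormedSpace ℝ E]
  {M : Type*} [TopologicalSpace M] [ChartedSpace E M]

theorem extChartAt_target_mem_nhds' {p : M} {y : E} (hy : y ∈ (extChartAt 𝓘(ℝ, E) p).target) :
    (extChartAt 𝓘(ℝ, E) p).target ∈ 𝓝 y :=
  (isOpen_extChartAt_target p).mem_nhds hy

/-- The value of a form at a point, as a form on the model space. -/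
def DiffForm.fiber {k : ℕ} (Ω : DiffForm E M k) (p : M) : E [⋀^Fin k]→L[ℝ] ℝ := Ω p

/-- The value of a vector field at a point, as a vector of the model space. -/
def VField.fiber (X : VField E M) (p : M) : E := X p

theorem chartRep_apply_pair (Ω : DiffForm E M 2) (p : M) (y u v : E) :
    chartRep Ω p y ![u, v] =
      Ω.fiber ((extChartAt 𝓘(ℝ, E) p).symm y) ![dChartSymm p y u, dChartSymm p y v] :=
  comp_pair _ _ _ _

variable [IsManifold 𝓘(ℝ, E) ∞ M]

theorem contMDiffAt_chartSymm {p : M} {y : E} (hy : y ∈ (extChartAt 𝓘(ℝ, E) p).target) :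
    ContMDiffAt 𝓘(ℝ, E) 𝓘(ℝ, E) ∞ (extChartAt 𝓘(ℝ, E) p).symm y :=
  (contMDiffOn_extChartAt_symm p).contMDiffAt (extChartAt_target_mem_nhds' hy)

theorem dChartSymm_isInvertible {p : M} {y : E} (hy : y ∈ (extChartAt 𝓘(ℝ, E) p).target) :
    (dChartSymm p y).IsInvertible := by
  have : IsManifold 𝓘(ℝ, E) 1 M := IsManifold.of_le (n := ∞) (by simp)
  have := isInvertible_mfderivWithin_extChartAt_symm (I := 𝓘(ℝ, E)) hy
  rwa [modelWithCornersSelf_coe, range_id, mfderivWithin_univ] at this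

theorem dChartSymm_inverse {p : M} {y : E} (hy : y ∈ (extChartAt 𝓘(ℝ, E) p).target) :
    (dChartSymm p y).inverse =
      mfderiv 𝓘(ℝ, E) 𝓘(ℝ, E) (extChartAt 𝓘(ℝ, E) p) ((extChartAt 𝓘(ℝ, E) p).symm y) := by
  have : IsManifold 𝓘(ℝ, E) 1 M := IsManifold.of_le (n := ∞) (by simp)
  have h1 := mfderivWithin_extChartAt_symm_comp_mfderiv_extChartAt (I := 𝓘(ℝ, E)) hy
  have h2 := mfderiv_extChartAt_comp_mfderivWithin_extChartAt_symm (I := 𝓘(ℝ, E)) hy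
  rw [modelWithCornersSelf_coe, range_id, mfderivWithin_univ] at h1 h2
  exact ContinuousLinearMap.inverse_eq h1 h2

theorem dChart_isInvertible (p : M) : (dChart E p).IsInvertible := by
  have : IsManifold 𝓘(ℝ, E) 1 M := IsManifold.of_le (n := ∞) (by simp)
  exact isInvertible_mfderiv_extChartAt (mem_extChartAt_source p)

/-- The differential of a function in a chart. -/
theorem fderiv_comp_chartSymm {p : M} {y : E} (hy : y ∈ (extChartAt 𝓘(ℝ, E) p).target)
    {K : M → ℝ} (hK : MDifferentiableAt 𝓘(ℝ, E) 𝓘(ℝ, ℝ) K ((extChartAt 𝓘(ℝ, E) p).symm y))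
    (v : E) :
    fderiv ℝ (K ∘ (extChartAt 𝓘(ℝ, E) p).symm) y v =
      dAt (E := E) K ((extChartAt 𝓘(ℝ, E) p).symm y) (dChartSymm p y v) := by
  rw [← mfderiv_eq_fderiv, mfderiv_comp y hK ((contMDiffAt_chartSymm hy).mdifferentiableAt
    (by simp))]
  rfl

theorem dChartSymm_chartRepVF (X : VField E M) {p : M} {y : E}
    (hy : y ∈ (extChartAt 𝓘(ℝ, E) p).target) :
    dChartSymm p y (chartRepVF X p y) = X.fiber ((extChartAt 𝓘(ℝ, E) p).symm y) :=
  (dChartSymm_isInvertible hy).self_apply_inverse _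

theorem chartRep_nondeg {Ω : DiffForm E M 2} {p : M} (h : NondegAt Ω p) (u : E)
    (hu : ∀ v, chartRep Ω p (extChartAt 𝓘(ℝ, E) p p) ![u, v] = 0) : u = 0 := by
  have hy := mem_extChartAt_target (I := 𝓘(ℝ, E)) p
  have hp : (extChartAt 𝓘(ℝ, E) p).symm (extChartAt 𝓘(ℝ, E) p p) = p := extChartAt_to_inv p
  apply (dChartSymm_isInvertible hy).injective
  rw [map_zero]
  rw [← hp] at h
  refine h _ fun v => ?_
  obtain ⟨v, rfl⟩ := (dChartSymm_isInvertible hy).surjective v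
  exact (chartRep_apply_pair Ω p _ u v).symm.trans (hu v)

/-- If a form vanishes after pullback by the chart derivative, it vanishes. -/
theorem extD_eq_zero_iff {k : ℕ} {Ω : DiffForm E M k} {p : M} :
    extD Ω p = 0 ↔ extDeriv (chartRep Ω p) (extChartAt 𝓘(ℝ, E) p p) = 0 := by
  constructor
  · intro h
    ext v
    choose w hw using fun i => (dChart_isInvertible (E := E) p).surjective (v i)
    have h1 : (extDeriv (chartRep Ω p) (extChartAt 𝓘(ℝ, E) p p)).compContinuousLinearMap
      (dChart E p) w = 0 := congrArg (fun a : E [⋀^Fin (k + 1)]→L[ℝ] ℝ => a w) h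
    rw [ContinuousAlternatingMap.compContinuousLinearMap_apply] at h1
    rw [← funext hw]
    exact h1
  · intro h
    change (extDeriv (chartRep Ω p) (extChartAt 𝓘(ℝ, E) p p)).compContinuousLinearMap
      (dChart E p) = 0
    rw [h]
    rfl

/-- Near `p`, `X` is a Hamiltonian vector field of `Ω`, with a Hamiltonian given in the chart
at `p`. -/
def IsLocallyHamiltonianAt (Ω : DiffForm E M 2) (X : VField E M) (p : M) : Prop :=
  ∃ κ : E → ℝ, ContDiffAt ℝ ∞ κ (extChartAt 𝓘(ℝ, E) p p) ∧
    ∀ᶠ y in 𝓝 (extChartAt 𝓘(ℝ, E) p p), ∀ v,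
      chartRep Ω p y ![chartRepVF X p y, v] = - fderiv ℝ κ y v

theorem isLocallyHamiltonianAt_of_function {Ω : DiffForm E M 2} {X : VField E M} {p : M}
    {K : M → ℝ} {U : Set M} (hU : IsOpen U) (hp : p ∈ U)
    (hK : ContMDiffOn 𝓘(ℝ, E) 𝓘(ℝ, ℝ) ∞ K U)
    (h : ∀ q ∈ U, ∀ v : TangentSpace 𝓘(ℝ, E) q, Ω q ![X q, v] = - dAt K q v) :
    IsLocallyHamiltonianAt Ω X p := by
  have hy := mem_extChartAt_target (I := 𝓘(ℝ, E)) p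
  have hp' : (extChartAt 𝓘(ℝ, E) p).symm (extChartAt 𝓘(ℝ, E) p p) = p := extChartAt_to_inv p
  refine ⟨K ∘ (extChartAt 𝓘(ℝ, E) p).symm, ?_, ?_⟩
  · rw [← contMDiffAt_iff_contDiffAt]
    refine ContMDiffAt.comp _ ?_ (contMDiffAt_chartSymm hy)
    rw [hp']
    exact hK.contMDiffAt (hU.mem_nhds hp)
  · have hc : ∀ᶠ y in 𝓝 (extChartAt 𝓘(ℝ, E) p p), (extChartAt 𝓘(ℝ, E) p).symm y ∈ U := by
      apply (contMDiffAt_chartSymm hy).continuousAt.eventually_mem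
      rw [hp']
      exact hU.mem_nhds hp
    filter_upwards [hc, extChartAt_target_mem_nhds' hy] with y hyU hyt v
    rw [chartRep_apply_pair, dChartSymm_chartRepVF X hyt, fderiv_comp_chartSymm hyt
      ((hK.contMDiffAt (hU.mem_nhds hyU)).mdifferentiableAt (by simp))]
    exact h _ hyU _

variable [FiniteDimensional ℝ E]

/-- Smoothness of `X` is a conclusion: in the chart `X` is the inverse of the pairing applied to
`-dκ`, and inversion of operators is smooth. This is how the field becomes smooth across `Z`. -/
theorem IsLocallyHamiltonianAt.contDiffAt {Ω : DiffForm E M 2} {X : VField E M} {p : M}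
    (h : IsLocallyHamiltonianAt Ω X p) (hΩ : SmoothFormAt Ω p) (hn : NondegAt Ω p) :
    ContDiffAt ℝ ∞ (chartRepVF X p) (extChartAt 𝓘(ℝ, E) p p) := by
  obtain ⟨κ, hκ, he⟩ := h
  have hB : ContDiffAt ℝ ∞ (fun y => pairing E (chartRep Ω p y)) (extChartAt 𝓘(ℝ, E) p p) :=
    contDiff_pairing.contDiffAt.comp _ hΩ
  have hinv := pairing_isInvertible (chartRep_nondeg hn)
  have hinv' : ∀ᶠ y in 𝓝 (extChartAt 𝓘(ℝ, E) p p),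
      (pairing E (chartRep Ω p y)).IsInvertible := by
    obtain ⟨e, he⟩ := hinv
    have := hB.continuousAt.eventually_mem (he ▸ e.nhds)
    filter_upwards [this] with y hy
    exact hy
  have hi : ContDiffAt ℝ ∞ (fun y => (pairing E (chartRep Ω p y)).inverse)
      (extChartAt 𝓘(ℝ, E) p p) :=
    ContDiffAt.comp (f := fun y => pairing E (chartRep Ω p y)) _ hinv.contDiffAt_map_inverse hB
  have hd : ContDiffAt ℝ ∞ (fderiv ℝ κ) (extChartAt 𝓘(ℝ, E) p p) := hκ.fderiv_right (by simp)
  refine (hi.clm_apply hd.neg).congr_of_eventuallyEq ?_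
  filter_upwards [he, hinv'] with y hy hyi
  rw [eq_comm, hyi.inverse_apply_eq]
  ext v
  simp [hy]

/-- Near `p` the field is the pullback, by the chart at `p`, of its expression in that chart. -/
theorem contMDiffAt_of_chartRepVF {X : VField E M} {p : M}
    (h : ContDiffAt ℝ ∞ (chartRepVF X p) (extChartAt 𝓘(ℝ, E) p p)) :
    ContMDiffAt 𝓘(ℝ, E) 𝓘(ℝ, E).tangent ∞
      (fun p => (⟨p, X p⟩ : TangentBundle 𝓘(ℝ, E) M)) p := by
  have : IsManifold 𝓘(ℝ, E) 1 M := IsManifold.of_le (n := ∞) (by simp)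
  have : IsManifold 𝓘(ℝ, E) (∞ + 1) M := by simpa using (inferInstance : IsManifold 𝓘(ℝ, E) ∞ M)
  have h1 := (contMDiffAt_vectorSpace_iff_contDiffAt (E := E) (V := chartRepVF X p)).2 h
  have h2 := ContMDiffAt.mpullback_vectorField_preimage (n := ∞) h1
    (contMDiffAt_extChartAt (x := p)) (dChart_isInvertible (E := E) p) (by simp)
  refine h2.congr_of_eventuallyEq ?_
  filter_upwards [extChartAt_source_mem_nhds (I := 𝓘(ℝ, E)) p] with q hq
  obtain ⟨y, hy, rfl⟩ : ∃ y ∈ (extChartAt 𝓘(ℝ, E) p).target, (extChartAt 𝓘(ℝ, E) p).symm y = q :=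
    ⟨_, (extChartAt 𝓘(ℝ, E) p).map_source hq, (extChartAt 𝓘(ℝ, E) p).left_inv hq⟩
  congr 1
  have h3 := dChartSymm_inverse (E := E) hy
  have h4 : (mfderiv 𝓘(ℝ, E) 𝓘(ℝ, E) (extChartAt 𝓘(ℝ, E) p)
    ((extChartAt 𝓘(ℝ, E) p).symm y) : E →L[ℝ] E).inverse = dChartSymm p y := by
    rw [← h3]
    exact (dChartSymm_isInvertible (E := E) hy).inverse_inverse
  have h5 : chartRepVF X p (extChartAt 𝓘(ℝ, E) p ((extChartAt 𝓘(ℝ, E) p).symm y)) =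
      chartRepVF X p y := by
    rw [(extChartAt 𝓘(ℝ, E) p).right_inv hy]
  exact ((DFunLike.congr h4 h5).trans (dChartSymm_chartRepVF X hy)).symm

theorem two_le_smooth : minSmoothness ℝ 2 ≤ ∞ := by
  rw [minSmoothness_of_isRCLikeNormedField]
  exact WithTop.coe_le_coe.2 le_top

omit [FiniteDimensional ℝ E] in
/-- Cartan's formula: a Hamiltonian vector field preserves a closed form. -/
theorem lie_derivative_eq_zero {η : E → E [⋀^Fin 2]→L[ℝ] ℝ} {ξ : E → E} {κ : E → ℝ} {y₀ : E}
    (hΩ : ContDiffAt ℝ ∞ η y₀) (hX : ContDiffAt ℝ ∞ ξ y₀) (hκ : ContDiffAt ℝ ∞ κ y₀)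
    (hc : extDeriv η y₀ = 0) (he : ∀ᶠ y in 𝓝 y₀, ∀ v, η y ![ξ y, v] = - fderiv ℝ κ y v)
    (w : Fin 2 → E) :
    fderiv ℝ η y₀ (ξ y₀) w + ∑ i, η y₀ (Function.update w i (fderiv ℝ ξ y₀ (w i))) = 0 := by
  have hηd : DifferentiableAt ℝ η y₀ := hΩ.differentiableAt (by simp)
  have hξd : DifferentiableAt ℝ ξ y₀ := hX.differentiableAt (by simp)
  have hB : DifferentiableAt ℝ (fun y => pairing E (η y)) y₀ :=
    (contDiff_pairing (n := 1)).contDiffAt.differentiableAt (by simp) |>.comp y₀ hηd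
  have hD : ∀ u a b, fderiv ℝ η y₀ u ![a, b] = fderiv ℝ (fun y => η y ![a, b]) y₀ u :=
    fun u a b => (fderiv_continuousAlternatingMap_apply_const_apply hηd _ _).symm
  have hD' : ∀ u a b, fderiv ℝ (fun y => pairing E (η y)) y₀ u a b = fderiv ℝ η y₀ u ![a, b] := by
    intro u a b
    have h1 := (((hB.hasFDerivAt.clm_apply (hasFDerivAt_const a y₀)).clm_apply
      (hasFDerivAt_const b y₀)).fderiv)
    have h2 := congrArg (fun c : E →L[ℝ] ℝ => c u) h1
    simp only [pairing_apply] at h2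
    rw [hD, h2]
    simp
  have hκ2 : DifferentiableAt ℝ (fderiv ℝ κ) y₀ :=
    (hκ.fderiv_right (m := ∞) (by simp)).differentiableAt (by simp)
  have hsymm := hκ.isSymmSndFDerivAt two_le_smooth
  -- This is the identity `η(ξ, a) = -dκ(a)` differentiated in the direction `u`. Antisymmetrizing
  -- it in `u` and `a` removes the Hessian of `κ`, and closedness of `η` on `(ξ, a, b)` turns the
  -- rest into the Lie derivative.
  have key : ∀ u a, fderiv ℝ η y₀ u ![ξ y₀, a] + η y₀ ![fderiv ℝ ξ y₀ u, a] =
      - fderiv ℝ (fderiv ℝ κ) y₀ u a := by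
    intro u a
    have h1 : HasFDerivAt (fun y => pairing E (η y) (ξ y) a) _ y₀ :=
      (hB.hasFDerivAt.clm_apply hξd.hasFDerivAt).clm_apply (hasFDerivAt_const a y₀)
    have h2 : HasFDerivAt (fun y => - fderiv ℝ κ y a) _ y₀ :=
      (hκ2.hasFDerivAt.clm_apply (hasFDerivAt_const a y₀)).neg
    have h3 : (fun y => pairing E (η y) (ξ y) a) =ᶠ[𝓝 y₀] fun y => - fderiv ℝ κ y a := by
      filter_upwards [he] with y hy
      rw [pairing_apply, hy]
    have h4 := congrArg (fun c : E →L[ℝ] ℝ => c u) (h1.unique (h2.congr_of_eventuallyEq h3))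
    simpa [hD', add_comm] using h4
  have hcl : ∀ a b c, fderiv ℝ η y₀ a ![b, c] - fderiv ℝ η y₀ b ![a, c] +
      fderiv ℝ η y₀ c ![a, b] = 0 := by
    intro a b c
    rw [hD, hD, hD]
    exact (extDeriv_two_eq_zero_iff hηd).1 hc a b c
  have hwv : w = ![w 0, w 1] := by
    ext i
    fin_cases i <;> rfl
  generalize w 0 = a at hwv
  generalize w 1 = b at hwv
  subst hwv
  have u0 : Function.update ![a, b] 0 (fderiv ℝ ξ y₀ a) = ![fderiv ℝ ξ y₀ a, b] := by
    ext i; fin_cases i <;> rfl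
  have u1 : Function.update ![a, b] 1 (fderiv ℝ ξ y₀ b) = ![a, fderiv ℝ ξ y₀ b] := by
    ext i; fin_cases i <;> rfl
  simp only [Fin.sum_univ_two, Matrix.cons_val_zero, Matrix.cons_val_one]
  rw [u0, u1]
  have k1 := key a b
  have k2 := key b a
  have k3 := hsymm a b
  have k4 := hcl (ξ y₀) a b
  rw [form_swap _ a (fderiv ℝ ξ y₀ b)]
  rw [k3] at k1
  linarith

theorem IsLocallyHamiltonianAt.lieD_eq_zero {Ω : DiffForm E M 2} {X : VField E M} {p : M}
    (h : IsLocallyHamiltonianAt Ω X p) (hΩ : SmoothFormAt Ω p) (hn : NondegAt Ω p)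
    (hc : extD Ω p = 0) (v : Fin 2 → TangentSpace 𝓘(ℝ, E) p) : lieD X Ω p v = 0 := by
  have hX := h.contDiffAt hΩ hn
  obtain ⟨κ, hκ, he⟩ := h
  exact lie_derivative_eq_zero hΩ hX hκ (extD_eq_zero_iff.1 hc) he fun i => dChart E p (v i)

end Charts

/-! ### Smoothness and closedness of `dr ∧ A + b`, with `φ` absorbed in `A` -/

section Model

variable {F : Type*} [NormedAddCommGroup F] [NormedSpace ℝ F]

theorem contDiff_covec {n : WithTop ℕ∞} :
    ContDiff ℝ n (fun a : F [⋀^Fin 1]→L[ℝ] ℝ => covec a) :=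
  (ContinuousAlternatingMap.ofSubsingletonLIE (𝕜 := ℝ) (E := F) (F := ℝ)
    (0 : Fin 1)).symm.toContinuousLinearEquiv.contDiff

/-- The components of a closed 1-form have symmetric derivative. -/
theorem fderiv_covec_symm {η : F → F [⋀^Fin 1]→L[ℝ] ℝ} {x : F} (hη : DifferentiableAt ℝ η x)
    (hc : extDeriv η x = 0) (u w : F) :
    fderiv ℝ (fun y => covec (η y)) x u w = fderiv ℝ (fun y => covec (η y)) x w u := by
  have hd : DifferentiableAt ℝ (fun y => covec (η y)) x :=
    (contDiff_covec (n := 1)).contDiffAt.differentiableAt (by simp) |>.comp x hη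
  have hD : ∀ u w, fderiv ℝ (fun y => covec (η y)) x u w = fderiv ℝ (fun y => η y ![w]) x u := by
    intro u w
    have h1 := (hd.hasFDerivAt.clm_apply (hasFDerivAt_const w x)).fderiv
    have h2 := congrArg (fun c : F →L[ℝ] ℝ => c u) h1
    simp only [covec_apply] at h2
    rw [h2]
    simp
  have h1 := (extDeriv_apply hη ![u, w]).trans (Fin.sum_univ_two _)
  have e0 : (0 : Fin 2).removeNth ![u, w] = ![w] := by ext i; fin_cases i; rfl
  have e1 : (1 : Fin 2).removeNth ![u, w] = ![u] := by ext i; fin_cases i; rfl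
  rw [hc, e0, e1] at h1
  change (0 : ℝ) = (-1) ^ 0 • fderiv ℝ (fun y => η y ![w]) x u +
      (-1) ^ 1 • fderiv ℝ (fun y => η y ![u]) x w at h1
  norm_num at h1
  rw [hD, hD]
  linarith

variable {m : ℕ} {a : ℕ → F → F →L[ℝ] ℝ} {b : F → F [⋀^Fin 2]→L[ℝ] ℝ} {φ : ℝ → ℝ}
  {r₀ : ℝ} {x₀ : F} {η : ℝ × F → (ℝ × F) [⋀^Fin 2]→L[ℝ] ℝ} {A : ℝ × F → F →L[ℝ] ℝ}

theorem contDiffAt_coefficient [FiniteDimensional ℝ F] (hφ : ContDiffAt ℝ ∞ φ r₀)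
    (ha : ∀ i < m, ContDiffAt ℝ ∞ (a i) x₀)
    (hA : ∀ y, A y = φ y.1 • ∑ i ∈ Finset.range m, y.1 ^ i • a i y.2) :
    ContDiffAt ℝ ∞ A (r₀, x₀) := by
  rw [contDiffAt_clm_apply_iff]
  intro u
  have h : (fun y => A y u) = fun y => φ y.1 * ∑ i ∈ Finset.range m, y.1 ^ i * a i y.2 u := by
    ext y
    simp [hA]
  rw [h]
  refine ContDiffAt.mul (hφ.comp (r₀, x₀) contDiffAt_fst) (ContDiffAt.sum fun i hi => ?_)
  refine ContDiffAt.mul (f := fun y : ℝ × F => y.1 ^ i) (contDiffAt_fst.pow i) ?_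
  exact ((ha i (Finset.mem_range.1 hi)).comp (r₀, x₀) contDiffAt_snd).clm_apply contDiffAt_const

theorem contDiffAt_model [FiniteDimensional ℝ F] (hφ : ContDiffAt ℝ ∞ φ r₀)
    (ha : ∀ i < m, ContDiffAt ℝ ∞ (a i) x₀) (hb : ContDiffAt ℝ ∞ b x₀)
    (hA : ∀ y, A y = φ y.1 • ∑ i ∈ Finset.range m, y.1 ^ i • a i y.2)
    (hη : ∀ y v w, η y ![v, w] = v.1 * A y w.2 - w.1 * A y v.2 + b y.2 ![v.2, w.2]) :
    ContDiffAt ℝ ∞ η (r₀, x₀) := by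
  rw [contDiffAt_form_iff]
  intro v w
  simp only [hη]
  have hA := contDiffAt_coefficient hφ ha hA
  refine ContDiffAt.add (ContDiffAt.sub (contDiffAt_const.mul (hA.clm_apply contDiffAt_const))
    (contDiffAt_const.mul (hA.clm_apply contDiffAt_const))) ?_
  exact (contDiffAt_form_iff.1 hb v.2 w.2).comp (r₀, x₀) contDiffAt_snd

/-- The exterior derivative is `-dr ∧ dA + db`. Only the part of `dA` along `F` survives the wedge
with `dr`; it is `φ(r) ∑ r^i da_i`, which vanishes because the derivatives of the `a_i` are
symmetric. -/
theorem extDeriv_model [FiniteDimensional ℝ F] (hφ : ContDiffAt ℝ ∞ φ r₀)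
    (ha : ∀ i < m, ContDiffAt ℝ ∞ (a i) x₀) (hb : ContDiffAt ℝ ∞ b x₀)
    (has : ∀ i < m, ∀ u w, fderiv ℝ (a i) x₀ u w = fderiv ℝ (a i) x₀ w u)
    (hbc : extDeriv b x₀ = 0)
    (hA : ∀ y, A y = φ y.1 • ∑ i ∈ Finset.range m, y.1 ^ i • a i y.2)
    (hη : ∀ y v w, η y ![v, w] = v.1 * A y w.2 - w.1 * A y v.2 + b y.2 ![v.2, w.2]) :
    extDeriv η (r₀, x₀) = 0 := by
  have hd : DifferentiableAt ℝ η (r₀, x₀) :=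
    (contDiffAt_model hφ ha hb hA hη).differentiableAt (by simp)
  have hAd := (contDiffAt_coefficient hφ ha hA).differentiableAt (by simp)
  have hbd : DifferentiableAt ℝ b x₀ := hb.differentiableAt (by simp)
  rw [extDeriv_two_eq_zero_iff hbd] at hbc
  rw [extDeriv_two_eq_zero_iff hd]
  have hsymm : ∀ u w, fderiv ℝ A (r₀, x₀) (0, u) w = fderiv ℝ A (r₀, x₀) (0, w) u := by
    have key : ∀ u w, fderiv ℝ A (r₀, x₀) (0, u) w =
        φ r₀ * ∑ i ∈ Finset.range m, r₀ ^ i * fderiv ℝ (a i) x₀ u w := by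
      intro u w
      have h1 : HasFDerivAt (fun x => φ r₀ * ∑ i ∈ Finset.range m, r₀ ^ i * a i x w)
          (φ r₀ • ∑ i ∈ Finset.range m, r₀ ^ i • (fderiv ℝ (a i) x₀).flip w) x₀ := by
        refine HasFDerivAt.const_mul (HasFDerivAt.fun_sum fun i hi => HasFDerivAt.const_mul ?_ _) _
        have := ((ha i (Finset.mem_range.1 hi)).differentiableAt (by simp)).hasFDerivAt.clm_apply
          (hasFDerivAt_const w x₀)
        simpa using this
      have h2 := (hAd.hasFDerivAt.comp x₀ (hasFDerivAt_prodMk_right r₀ x₀)).clm_apply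
        (hasFDerivAt_const w x₀)
      have h3 : (fun x => φ r₀ * ∑ i ∈ Finset.range m, r₀ ^ i * a i x w) =
          fun x => (A ∘ fun y => (r₀, y)) x w := by
        ext x
        simp [hA]
      rw [h3] at h1
      have h4 := DFunLike.congr_fun (h2.unique h1) u
      simpa using h4
    intro u w
    rw [key, key]
    congr 1
    refine Finset.sum_congr rfl fun i hi => ?_
    rw [has i (Finset.mem_range.1 hi)]
  have hD : ∀ u v w : ℝ × F, fderiv ℝ (fun y => η y ![v, w]) (r₀, x₀) u =
      v.1 * fderiv ℝ A (r₀, x₀) u w.2 - w.1 * fderiv ℝ A (r₀, x₀) u v.2 +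
        fderiv ℝ (fun x => b x ![v.2, w.2]) x₀ u.2 := by
    intro u v w
    have hbvw : DifferentiableAt ℝ (fun x => b x ![v.2, w.2]) x₀ :=
      (contDiffAt_form_iff.1 hb v.2 w.2).differentiableAt (by simp)
    have h1 := (((hAd.hasFDerivAt.clm_apply (hasFDerivAt_const w.2 (r₀, x₀))).const_mul v.1).sub
      ((hAd.hasFDerivAt.clm_apply (hasFDerivAt_const v.2 (r₀, x₀))).const_mul w.1)).add
      (hbvw.hasFDerivAt.comp (r₀, x₀) hasFDerivAt_snd)
    have h2 := h1.fderiv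
    simp only [hη]
    refine (DFunLike.congr_fun h2 u).trans ?_
    simp
  have hlin : ∀ (u : ℝ × F) (w : F), fderiv ℝ A (r₀, x₀) u w =
      u.1 * fderiv ℝ A (r₀, x₀) (1, 0) w + fderiv ℝ A (r₀, x₀) (0, u.2) w := by
    intro u w
    have : u = u.1 • ((1 : ℝ), (0 : F)) + (0, u.2) := by ext <;> simp
    conv_lhs => rw [this]
    rw [map_add, map_smul]
    rfl
  intro u v w
  -- After splitting into radial and tangential derivatives, the radial ones cancel in the cyclic
  -- sum and the tangential ones cancel by `hsymm`; what remains is the closedness of `b`.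
  rw [hD, hD, hD, hlin u w.2, hlin u v.2, hlin v w.2, hlin v u.2, hlin w u.2, hlin w v.2,
    hsymm u.2 w.2, hsymm u.2 v.2, hsymm v.2 w.2]
  linear_combination hbc u.2 v.2 w.2

end Model

/-! ### Local inverses and transport of smooth closed forms -/

section LocalInverse

variable {E V : Type*} [NormedAddCommGroup E] [NormedSpace ℝ E] [FiniteDimensional ℝ E]
  [NormedAddCommGroup V] [NormedSpace ℝ V] [FiniteDimensional ℝ V]

omit [FiniteDimensional ℝ E] in
theorem exists_smooth_local_inverse {G : V → E} {y₀ : V} (hG : ContDiffAt ℝ ∞ G y₀)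
    (hi : (fderiv ℝ G y₀).IsInvertible) :
    ∃ g : E → V, ContDiffAt ℝ ∞ g (G y₀) ∧ g (G y₀) = y₀ ∧ ∀ᶠ Y in 𝓝 (G y₀), G (g Y) = Y ∧
      ∀ v, fderiv ℝ G (g Y) (fderiv ℝ g Y v) = v := by
  have : CompleteSpace V := FiniteDimensional.complete ℝ V
  obtain ⟨e, he⟩ := hi
  have hf : HasFDerivAt G (e : V →L[ℝ] E) y₀ :=
    he ▸ (hG.differentiableAt (by simp)).hasFDerivAt
  have hs : HasStrictFDerivAt G (e : V →L[ℝ] E) y₀ :=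
    hG.hasStrictFDerivAt' hf (by simp)
  have hg : ContDiffAt ℝ ∞ (hG.localInverse hf (by simp)) (G y₀) :=
    hG.to_localInverse hf (by simp)
  have hg0 : hG.localInverse hf (by simp) (G y₀) = y₀ := hG.localInverse_apply_image hf (by simp)
  have hr : ∀ᶠ Y in 𝓝 (G y₀), G (hG.localInverse hf (by simp) Y) = Y :=
    hs.eventually_right_inverse
  refine ⟨hG.localInverse hf (by simp), hg, hg0, ?_⟩
  generalize hG.localInverse hf (by simp) = g at *
  have h1 : ∀ᶠ y in 𝓝 y₀, ContDiffAt ℝ 1 G y :=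
    (hG.of_le (m := 1) (by simp)).eventually (by simp)
  have h2 : ∀ᶠ Y in 𝓝 (G y₀), ContDiffAt ℝ 1 g Y :=
    (hg.of_le (m := 1) (by simp)).eventually (by simp)
  have hc : Filter.Tendsto g (𝓝 (G y₀)) (𝓝 y₀) := by
    have := hg.continuousAt.tendsto
    rwa [hg0] at this
  -- `G ∘ g = id` is needed on a neighbourhood of `Y`, not only at `Y`, in order to be
  -- differentiated there.
  filter_upwards [hr, hr.eventually_nhds, h2, hc.eventually h1] with Y hY hY' hgY hGY
  refine ⟨hY, fun v => ?_⟩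
  have h3 := ((hGY.differentiableAt (by simp)).hasFDerivAt.comp Y
    (hgY.differentiableAt (by simp)).hasFDerivAt).congr_of_eventuallyEq
    (f₁ := id) (hY'.mono fun Z hZ => hZ.symm)
  exact DFunLike.congr_fun (h3.unique (hasFDerivAt_id Y)) v

/-- Smoothness and closedness of a form can be checked after pullback by a local
diffeomorphism. -/
theorem smooth_closed_of_pullback {G : V → E} {y₀ : V} (hG : ContDiffAt ℝ ∞ G y₀)
    (hi : (fderiv ℝ G y₀).IsInvertible) {η : E → E [⋀^Fin 2]→L[ℝ] ℝ} {θ : V → V [⋀^Fin 2]→L[ℝ] ℝ}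
    (hθ : ContDiffAt ℝ ∞ θ y₀) (hc : extDeriv θ y₀ = 0)
    (h : ∀ᶠ y in 𝓝 y₀, ∀ u v, η (G y) ![fderiv ℝ G y u, fderiv ℝ G y v] = θ y ![u, v]) :
    ContDiffAt ℝ ∞ η (G y₀) ∧ extDeriv η (G y₀) = 0 := by
  obtain ⟨g, hg, hg0, hr⟩ := exists_smooth_local_inverse hG hi
  have hgc : Filter.Tendsto g (𝓝 (G y₀)) (𝓝 y₀) := by
    have := hg.continuousAt.tendsto
    rwa [hg0] at this
  -- Near `G y₀` the form `η` is the pullback of `θ` by the local inverse, and pullback preserves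
  -- smoothness and commutes with `d`.
  have he : η =ᶠ[𝓝 (G y₀)] fun Y => (θ (g Y)).compContinuousLinearMap (fderiv ℝ g Y) := by
    filter_upwards [hr, hgc.eventually h] with Y hY hYh
    ext w
    have hw : w = ![w 0, w 1] := by ext i; fin_cases i <;> rfl
    rw [hw, comp_pair, ← hYh, hY.1, hY.2, hY.2]
  have hθ' : ContDiffAt ℝ ∞ θ (g (G y₀)) := by rwa [hg0]
  constructor
  · exact (contDiffAt_pullback hθ' hg).congr_of_eventuallyEq he
  · rw [he.extDeriv_eq, extDeriv_pullback (hθ'.differentiableAt (by simp)) hg two_le_smooth, hg0,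
      hc]
    rfl

end LocalInverse

/-! ### Coordinates of the tubular neighbourhood and their transition to charts of `M` -/

namespace TubularNhd

variable {E : Type*} [NormedAddCommGroup E] [NormedSpace ℝ E]
  {M : Type*} [TopologicalSpace M] [ChartedSpace E M]
  {F : Type*} [NormedAddCommGroup F] [NormedSpace ℝ F]
  {S : Type*} [TopologicalSpace S] [ChartedSpace F S]
  {ι : S → M} {z : M → ℝ} (T : TubularNhd E F ι z)

/-- The tubular neighbourhood in the chart at `s₀`. -/
def coord (s₀ : S) (y : ℝ × F) : M := T.Ψ (y.1, (extChartAt 𝓘(ℝ, F) s₀).symm y.2)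

/-- The derivative of `coord`. -/
def dCoord (s₀ : S) (y : ℝ × F) : (ℝ × F) →L[ℝ] E :=
  (T.dΨ (y.1, (extChartAt 𝓘(ℝ, F) s₀).symm y.2)).comp
    ((ContinuousLinearMap.id ℝ ℝ).prodMap (dChartSymm s₀ y.2))

/-- The domain of `coord`. -/
def coordDomain (s₀ : S) : Set (ℝ × F) :=
  Ioo (-T.δ) T.δ ×ˢ (extChartAt 𝓘(ℝ, F) s₀).target

theorem isOpen_coordDomain (s₀ : S) : IsOpen (T.coordDomain s₀) :=
  isOpen_Ioo.prod (isOpen_extChartAt_target s₀)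

theorem mem_coordDomain {r : ℝ} (hr : r ∈ Ioo (-T.δ) T.δ) (s₀ : S) :
    (r, extChartAt 𝓘(ℝ, F) s₀ s₀) ∈ T.coordDomain s₀ :=
  ⟨hr, mem_extChartAt_target s₀⟩

theorem coord_self (r : ℝ) (s₀ : S) : T.coord s₀ (r, extChartAt 𝓘(ℝ, F) s₀ s₀) = T.Ψ (r, s₀) := by
  simp [coord]

theorem dCoord_apply (s₀ : S) (y u : ℝ × F) : T.dCoord s₀ y u =
    T.dΨ (y.1, (extChartAt 𝓘(ℝ, F) s₀).symm y.2) (u.1, dChartSymm s₀ y.2 u.2) := rfl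

theorem contMDiffAt_Ψ {q : ℝ × S} (hq : q.1 ∈ Ioo (-T.δ) T.δ) :
    ContMDiffAt (𝓘(ℝ, ℝ).prod 𝓘(ℝ, F)) 𝓘(ℝ, E) ∞ T.Ψ q :=
  (T.isLocalDiffeomorphOn ⟨q, hq, mem_univ _⟩).contMDiffAt

theorem dΨ_isInvertible {q : ℝ × S} (hq : q.1 ∈ Ioo (-T.δ) T.δ) : (T.dΨ q).IsInvertible :=
  ⟨(T.isLocalDiffeomorphOn ⟨q, hq, mem_univ _⟩).mfderivToContinuousLinearEquiv (by simp), rfl⟩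

/-- The transition map from the coordinates of the tubular neighbourhood to the chart at `p`. -/
def transition (s₀ : S) (p : M) (y : ℝ × F) : E := extChartAt 𝓘(ℝ, E) p (T.coord s₀ y)

theorem chartSymm_transition {s₀ : S} {p : M} {y : ℝ × F}
    (hp : T.coord s₀ y ∈ (extChartAt 𝓘(ℝ, E) p).source) :
    (extChartAt 𝓘(ℝ, E) p).symm (T.transition s₀ p y) = T.coord s₀ y :=
  (extChartAt 𝓘(ℝ, E) p).left_inv hp

theorem transition_self (r₀ : ℝ) (s₀ : S) :
    T.transition s₀ (T.Ψ (r₀, s₀)) (r₀, extChartAt 𝓘(ℝ, F) s₀ s₀) =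
      extChartAt 𝓘(ℝ, E) (T.Ψ (r₀, s₀)) (T.Ψ (r₀, s₀)) := by
  rw [transition, T.coord_self]

variable [IsManifold 𝓘(ℝ, F) ∞ S]

theorem contMDiffAt_chart {s₀ : S} {y : ℝ × F} (hy : y ∈ T.coordDomain s₀) :
    ContMDiffAt 𝓘(ℝ, ℝ × F) (𝓘(ℝ, ℝ).prod 𝓘(ℝ, F)) ∞
      (fun y : ℝ × F => (y.1, (extChartAt 𝓘(ℝ, F) s₀).symm y.2)) y :=
  (contMDiffAt_iff_contDiffAt.2 contDiffAt_fst).prodMk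
    ((contMDiffAt_chartSymm hy.2).comp y (contMDiffAt_iff_contDiffAt.2 contDiffAt_snd))

theorem mfderiv_chart {s₀ : S} {y : ℝ × F} (hy : y ∈ T.coordDomain s₀) :
    (mfderiv 𝓘(ℝ, ℝ × F) (𝓘(ℝ, ℝ).prod 𝓘(ℝ, F))
      (fun y : ℝ × F => (y.1, (extChartAt 𝓘(ℝ, F) s₀).symm y.2)) y : (ℝ × F) →L[ℝ] (ℝ × F)) =
      (ContinuousLinearMap.id ℝ ℝ).prodMap (dChartSymm s₀ y.2) := by
  have h1 : MDifferentiableAt 𝓘(ℝ, ℝ × F) 𝓘(ℝ, ℝ) (fun y : ℝ × F => y.1) y :=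
    (contMDiffAt_iff_contDiffAt.2 (contDiffAt_fst (n := 1))).mdifferentiableAt (by simp)
  have h2 : MDifferentiableAt 𝓘(ℝ, ℝ × F) 𝓘(ℝ, F) (fun y : ℝ × F => y.2) y :=
    (contMDiffAt_iff_contDiffAt.2 (contDiffAt_snd (n := 1))).mdifferentiableAt (by simp)
  have h3 : MDifferentiableAt 𝓘(ℝ, F) 𝓘(ℝ, F) (extChartAt 𝓘(ℝ, F) s₀).symm y.2 :=
    (contMDiffAt_chartSymm hy.2).mdifferentiableAt (by simp)
  have h4 := MDifferentiableAt.mfderiv_prod h1 (h3.comp y h2)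
  rw [mfderiv_comp y h3 h2] at h4
  have e1 : mfderiv 𝓘(ℝ, ℝ × F) 𝓘(ℝ, ℝ) (fun y : ℝ × F => y.1) y =
    ContinuousLinearMap.fst ℝ ℝ F := by rw [mfderiv_eq_fderiv]; exact fderiv_fst
  have e2 : mfderiv 𝓘(ℝ, ℝ × F) 𝓘(ℝ, F) (fun y : ℝ × F => y.2) y =
    ContinuousLinearMap.snd ℝ ℝ F := by rw [mfderiv_eq_fderiv]; exact fderiv_snd
  rw [e1, e2] at h4
  exact h4

theorem contMDiffAt_coord {s₀ : S} {y : ℝ × F} (hy : y ∈ T.coordDomain s₀) :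
    ContMDiffAt 𝓘(ℝ, ℝ × F) 𝓘(ℝ, E) ∞ (T.coord s₀) y :=
  ContMDiffAt.comp y (T.contMDiffAt_Ψ (q := (y.1, _)) hy.1) (T.contMDiffAt_chart hy)

theorem mfderiv_coord {s₀ : S} {y : ℝ × F} (hy : y ∈ T.coordDomain s₀) :
    (mfderiv 𝓘(ℝ, ℝ × F) 𝓘(ℝ, E) (T.coord s₀) y : (ℝ × F) →L[ℝ] E) = T.dCoord s₀ y := by
  have h := mfderiv_comp y ((T.contMDiffAt_Ψ (q := (y.1, (extChartAt 𝓘(ℝ, F) s₀).symm y.2))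
    hy.1).mdifferentiableAt (by simp)) ((T.contMDiffAt_chart hy).mdifferentiableAt (by simp))
  refine Eq.trans h ?_
  ext1 u
  exact congrArg (T.dΨ (y.1, (extChartAt 𝓘(ℝ, F) s₀).symm y.2))
    (DFunLike.congr_fun (T.mfderiv_chart hy) u)

theorem dCoord_isInvertible {s₀ : S} {y : ℝ × F} (hy : y ∈ T.coordDomain s₀) :
    (T.dCoord s₀ y).IsInvertible := by
  refine (T.dΨ_isInvertible (q := (y.1, _)) hy.1).comp ?_
  obtain ⟨e, he⟩ := dChartSymm_isInvertible hy.2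
  exact ⟨(ContinuousLinearEquiv.refl ℝ ℝ).prodCongr e, by ext <;> simp [← he]⟩

/-- The differential of a function in the coordinates of the tubular neighbourhood. -/
theorem fderiv_comp_coord {s₀ : S} {y : ℝ × F} (hy : y ∈ T.coordDomain s₀) {K : M → ℝ}
    (hK : MDifferentiableAt 𝓘(ℝ, E) 𝓘(ℝ, ℝ) K (T.coord s₀ y)) (u : ℝ × F) :
    fderiv ℝ (K ∘ T.coord s₀) y u = dAt (E := E) K (T.coord s₀ y) (T.dCoord s₀ y u) := by
  rw [← mfderiv_eq_fderiv, mfderiv_comp y hK ((T.contMDiffAt_coord hy).mdifferentiableAt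
    (by simp)), ← T.mfderiv_coord hy]
  rfl

variable [IsManifold 𝓘(ℝ, E) ∞ M]

theorem contDiffAt_transition {s₀ : S} {p : M} {y : ℝ × F} (hy : y ∈ T.coordDomain s₀)
    (hp : T.coord s₀ y ∈ (extChartAt 𝓘(ℝ, E) p).source) :
    ContDiffAt ℝ ∞ (T.transition s₀ p) y := by
  rw [← contMDiffAt_iff_contDiffAt]
  rw [extChartAt_source] at hp
  exact (contMDiffAt_extChartAt' hp).comp y (T.contMDiffAt_coord hy)

/-- Chain rule for `chart⁻¹ ∘ transition = coord`, which holds near `y`. -/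
theorem dChartSymm_fderiv_transition {s₀ : S} {p : M} {y : ℝ × F} (hy : y ∈ T.coordDomain s₀)
    (hp : T.coord s₀ y ∈ (extChartAt 𝓘(ℝ, E) p).source) (u : ℝ × F) :
    dChartSymm p (T.transition s₀ p y) (fderiv ℝ (T.transition s₀ p) y u) = T.dCoord s₀ y u := by
  have h1 := (T.contDiffAt_transition hy hp).differentiableAt (by simp)
  have ht : T.transition s₀ p y ∈ (extChartAt 𝓘(ℝ, E) p).target :=
    (extChartAt 𝓘(ℝ, E) p).map_source hp
  have h2 := mfderiv_comp y ((contMDiffAt_chartSymm ht).mdifferentiableAt (by simp))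
    h1.mdifferentiableAt
  have h3 : (extChartAt 𝓘(ℝ, E) p).symm ∘ T.transition s₀ p =ᶠ[𝓝 y] T.coord s₀ := by
    filter_upwards [(T.contMDiffAt_coord hy).continuousAt.eventually_mem
      ((isOpen_extChartAt_source p).mem_nhds hp)] with y' hy'
    exact (extChartAt 𝓘(ℝ, E) p).left_inv hy'
  have h4 := h3.mfderiv_eq (I := 𝓘(ℝ, ℝ × F)) (I' := 𝓘(ℝ, E))
  rw [← T.mfderiv_coord hy]
  rw [mfderiv_eq_fderiv] at h2
  exact (DFunLike.congr_fun h2 u).symm.trans (DFunLike.congr_fun h4 u)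

theorem fderiv_transition_isInvertible {s₀ : S} {p : M} {y : ℝ × F} (hy : y ∈ T.coordDomain s₀)
    (hp : T.coord s₀ y ∈ (extChartAt 𝓘(ℝ, E) p).source) :
    (fderiv ℝ (T.transition s₀ p) y).IsInvertible := by
  have ht : T.transition s₀ p y ∈ (extChartAt 𝓘(ℝ, E) p).target :=
    (extChartAt 𝓘(ℝ, E) p).map_source hp
  have h : fderiv ℝ (T.transition s₀ p) y =
      (dChartSymm p (T.transition s₀ p y)).inverse ∘L T.dCoord s₀ y := by
    refine ContinuousLinearMap.ext fun u => ?_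
    rw [ContinuousLinearMap.comp_apply, ← T.dChartSymm_fderiv_transition hy hp,
      (dChartSymm_isInvertible ht).inverse_apply_self]
  rw [h]
  exact (dChartSymm_isInvertible ht).inverse.comp (T.dCoord_isInvertible hy)

theorem chartRep_transition (Ω : DiffForm E M 2) {s₀ : S} {p : M} {y : ℝ × F}
    (hy : y ∈ T.coordDomain s₀) (hp : T.coord s₀ y ∈ (extChartAt 𝓘(ℝ, E) p).source)
    (u v : ℝ × F) :
    chartRep Ω p (T.transition s₀ p y) ![fderiv ℝ (T.transition s₀ p) y u,
      fderiv ℝ (T.transition s₀ p) y v] =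
      Ω.fiber (T.coord s₀ y) ![T.dCoord s₀ y u, T.dCoord s₀ y v] := by
  rw [chartRep_apply_pair, T.dChartSymm_fderiv_transition hy hp,
    T.dChartSymm_fderiv_transition hy hp]
  rw [T.chartSymm_transition hp]

omit [IsManifold 𝓘(ℝ, E) ∞ M] in
theorem eventually_mem_source {s₀ : S} {r₀ : ℝ} (hr : r₀ ∈ Ioo (-T.δ) T.δ) :
    ∀ᶠ y in 𝓝 (r₀, extChartAt 𝓘(ℝ, F) s₀ s₀), y ∈ T.coordDomain s₀ ∧
      T.coord s₀ y ∈ (extChartAt 𝓘(ℝ, E) (T.Ψ (r₀, s₀))).source := by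
  refine Filter.Eventually.and ((T.isOpen_coordDomain s₀).mem_nhds (T.mem_coordDomain hr s₀)) ?_
  apply (T.contMDiffAt_coord (T.mem_coordDomain hr s₀)).continuousAt.eventually_mem
  rw [T.coord_self]
  exact extChartAt_source_mem_nhds _

variable [FiniteDimensional ℝ E] [FiniteDimensional ℝ F]

/-- Smoothness and closedness on `M` are defined through the charts of `M`; this lets them be
checked in tubular coordinates, at points of `Z` too. -/
theorem smoothFormAt_extD_of_coord (Ω : DiffForm E M 2) {s₀ : S} {r₀ : ℝ}
    (hr : r₀ ∈ Ioo (-T.δ) T.δ) {θ : ℝ × F → (ℝ × F) [⋀^Fin 2]→L[ℝ] ℝ}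
    (hθ : ContDiffAt ℝ ∞ θ (r₀, extChartAt 𝓘(ℝ, F) s₀ s₀))
    (hc : extDeriv θ (r₀, extChartAt 𝓘(ℝ, F) s₀ s₀) = 0)
    (h : ∀ y ∈ T.coordDomain s₀, ∀ u v, Ω.fiber (T.coord s₀ y)
      ![T.dCoord s₀ y u, T.dCoord s₀ y v] = θ y ![u, v]) :
    SmoothFormAt Ω (T.Ψ (r₀, s₀)) ∧ extD Ω (T.Ψ (r₀, s₀)) = 0 := by
  have hs := T.eventually_mem_source (s₀ := s₀) hr
  have h0 := hs.self_of_nhds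
  rw [extD_eq_zero_iff, SmoothFormAt, ← T.transition_self]
  refine smooth_closed_of_pullback (T.contDiffAt_transition h0.1 h0.2)
    (T.fderiv_transition_isInvertible h0.1 h0.2) hθ hc ?_
  filter_upwards [hs] with y hy u v
  rw [T.chartRep_transition Ω hy.1 hy.2, h y hy.1]

omit [FiniteDimensional ℝ E] in
theorem isLocallyHamiltonianAt_of_coord (Ω : DiffForm E M 2) (X : VField E M) {s₀ : S} {r₀ : ℝ}
    (hr : r₀ ∈ Ioo (-T.δ) T.δ) {κ : ℝ × F → ℝ}
    (hκ : ContDiffAt ℝ ∞ κ (r₀, extChartAt 𝓘(ℝ, F) s₀ s₀))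
    (h : ∀ᶠ y in 𝓝 (r₀, extChartAt 𝓘(ℝ, F) s₀ s₀), ∀ u,
      Ω.fiber (T.coord s₀ y) ![X.fiber (T.coord s₀ y), T.dCoord s₀ y u] =
        - fderiv ℝ κ y u) :
    IsLocallyHamiltonianAt Ω X (T.Ψ (r₀, s₀)) := by
  have hs := T.eventually_mem_source (s₀ := s₀) hr
  have h0 := hs.self_of_nhds
  obtain ⟨g, hg, hg0, hgr⟩ := exists_smooth_local_inverse (T.contDiffAt_transition h0.1 h0.2)
    (T.fderiv_transition_isInvertible h0.1 h0.2)
  have hgc : Filter.Tendsto g (𝓝 (T.transition s₀ (T.Ψ (r₀, s₀))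
      (r₀, extChartAt 𝓘(ℝ, F) s₀ s₀))) (𝓝 (r₀, extChartAt 𝓘(ℝ, F) s₀ s₀)) := by
    have := hg.continuousAt.tendsto
    rwa [hg0] at this
  have hκ1 : ∀ᶠ y in 𝓝 (r₀, extChartAt 𝓘(ℝ, F) s₀ s₀), ContDiffAt ℝ 1 κ y :=
    (hκ.of_le (m := 1) (by simp)).eventually (by simp)
  have hg1 := (hg.of_le (m := 1) (by simp)).eventually (by simp)
  -- The Hamiltonian is carried to the chart of `M` by the local inverse `g` of the transition map.
  refine ⟨κ ∘ g, ?_, ?_⟩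
  · rw [← T.transition_self]
    exact ContDiffAt.comp _ (by rwa [hg0]) hg
  · rw [← T.transition_self]
    filter_upwards [hgr, hg1, hgc.eventually h, hgc.eventually hs, hgc.eventually hκ1] with
      Y hY hgY hXY hsY hκY v
    have h1 := fderiv_comp Y (hκY.differentiableAt (by simp)) (hgY.differentiableAt (by simp))
    rw [h1, ContinuousLinearMap.comp_apply, ← hXY, chartRep_apply_pair]
    have ht : Y ∈ (extChartAt 𝓘(ℝ, E) (T.Ψ (r₀, s₀))).target := by
      rw [← hY.1]
      exact (extChartAt 𝓘(ℝ, E) (T.Ψ (r₀, s₀))).map_source hsY.2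
    have hp := T.chartSymm_transition hsY.2
    have h2 := T.dChartSymm_fderiv_transition hsY.1 hsY.2 (fderiv ℝ g Y v)
    rw [hY.1] at hp
    rw [hY.1, hY.2] at h2
    rw [dChartSymm_chartRepVF X ht, h2, hp]

end TubularNhd

/-! ### The derivative of `f_ε` -/

section DesingFunction

variable {m : ℕ} {f : ℝ → ℝ}

theorem IsDesingFunction.deriv_neg (hf : IsDesingFunction m f) (x : ℝ) :
    deriv f (-x) = deriv f x := by
  have h1 : (fun x => f (-x)) = fun x => - f x := funext hf.odd
  have h2 := congrArg (fun g => deriv g x) h1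
  simp only [deriv_comp_neg, deriv.fun_neg] at h2
  linarith

theorem IsDesingFunction.deriv_of_one_lt (hf : IsDesingFunction m f) (hm : 1 ≤ m) {x : ℝ}
    (hx : 1 < x) : deriv f x = (x ^ (2 * m))⁻¹ := by
  have hx0 : x ≠ 0 := by positivity
  have hm' : (2 * m - 1 : ℝ) ≠ 0 := by
    have : (1 : ℝ) ≤ m := by exact_mod_cast hm
    linarith
  have he : f =ᶠ[𝓝 x] fun x => -1 / ((2 * m - 1) * x ^ (2 * m - 1)) + 2 := by
    filter_upwards [isOpen_Ioi.mem_nhds hx] with y hy using hf.right y hy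
  rw [he.deriv_eq]
  obtain ⟨k, rfl⟩ : ∃ k, m = k + 1 := ⟨m - 1, by omega⟩
  have e1 : 2 * (k + 1) - 1 = 2 * k + 1 := by omega
  rw [e1]
  have h1 : HasDerivAt (fun x : ℝ => (2 * ((k + 1 : ℕ) : ℝ) - 1) * x ^ (2 * k + 1))
      ((2 * ((k + 1 : ℕ) : ℝ) - 1) * ((2 * k + 1 : ℕ) * x ^ (2 * k))) x := by
    simpa using (hasDerivAt_pow (2 * k + 1) x).const_mul (2 * ((k + 1 : ℕ) : ℝ) - 1)
  have h2 := ((hasDerivAt_const x (-1 : ℝ)).div h1 (by positivity)).add_const 2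
  refine h2.deriv.trans ?_
  push_cast at hm' ⊢
  field_simp
  ring

/-- The formulas for `f` hold only for `|x| > 1`. The value at `1` follows by continuity of `f'`,
and negative `x` by evenness of `f'`. -/
theorem IsDesingFunction.deriv_of_one_le_abs (hf : IsDesingFunction m f) (hm : 1 ≤ m) {x : ℝ}
    (hx : 1 ≤ |x|) : deriv f x = (x ^ (2 * m))⁻¹ := by
  have hpos : ∀ x : ℝ, 1 ≤ x → deriv f x = (x ^ (2 * m))⁻¹ := by
    intro x hx
    rcases hx.lt_or_eq with h | rfl
    · exact hf.deriv_of_one_lt hm h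
    · have h1 : Filter.Tendsto (deriv f) (𝓝[>] 1) (𝓝 (deriv f 1)) :=
        ((hf.smooth.continuous_deriv (by simp)).tendsto 1).mono_left nhdsWithin_le_nhds
      have h2 : Filter.Tendsto (fun x : ℝ => (x ^ (2 * m))⁻¹) (𝓝[>] 1) (𝓝 ((1 ^ (2 * m))⁻¹)) :=
        (((continuous_pow (2 * m)).tendsto (1 : ℝ)).inv₀ (by simp)).mono_left nhdsWithin_le_nhds
      refine tendsto_nhds_unique h1 (h2.congr' ?_)
      filter_upwards [self_mem_nhdsWithin] with y hy using (hf.deriv_of_one_lt hm hy).symm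
  rcases le_total 0 x with h | h
  · exact hpos x (by rwa [abs_of_nonneg h] at hx)
  · have := hpos (-x) (by rwa [abs_of_nonpos h] at hx)
    rwa [hf.deriv_neg, (even_two_mul m).neg_pow] at this

theorem IsDesingFunction.contDiff_fEps (hf : IsDesingFunction m f) (ε : ℝ) :
    ContDiff ℝ ∞ (fEps m f ε) :=
  contDiff_const.mul (hf.smooth.comp (contDiff_id.div_const ε))

theorem IsDesingFunction.deriv_fEps (hf : IsDesingFunction m f) (ε x : ℝ) :
    deriv (fEps m f ε) x = (ε ^ (2 * m - 1))⁻¹ * (deriv f (x / ε) / ε) := by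
  have h1 : HasDerivAt (fEps m f ε) _ x :=
    (((hf.smooth.differentiable (by simp)) (x / ε)).hasDerivAt.comp x
      ((hasDerivAt_id x).div_const ε)).const_mul (ε ^ (2 * m - 1))⁻¹
  rw [h1.deriv]
  ring

/-- The power of `ε` in `f_ε` is chosen for this: `ε^{-(2m-1)} · ε^{-1} · (x/ε)^{-2m} = x^{-2m}`, so
the coefficient agrees with that of `Ω` beyond `ε`. -/
theorem IsDesingFunction.deriv_fEps_of_le (hf : IsDesingFunction m f) (hm : 1 ≤ m) {ε x : ℝ}
    (hε : 0 < ε) (hx : ε ≤ |x|) : deriv (fEps m f ε) x = (x ^ (2 * m))⁻¹ := by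
  rw [hf.deriv_fEps, hf.deriv_of_one_le_abs hm]
  · have hx0 : x ≠ 0 := abs_pos.1 (hε.trans_le hx)
    obtain ⟨k, hk⟩ : ∃ k, 2 * m = k + 1 := ⟨2 * m - 1, by omega⟩
    rw [hk, Nat.add_sub_cancel, div_pow, pow_succ ε]
    field_simp
  · rwa [abs_div, abs_of_pos hε, le_div_iff₀ hε, one_mul]

theorem IsDesingFunction.deriv_fEps_pos (hf : IsDesingFunction m f) (hm : 1 ≤ m) {ε : ℝ}
    (hε : 0 < ε) (x : ℝ) : 0 < deriv (fEps m f ε) x := by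
  rcases le_total ε |x| with h | h
  · have hx0 : x ≠ 0 := abs_pos.1 (hε.trans_le h)
    rw [hf.deriv_fEps_of_le hm hε h, ← (even_two_mul m).pow_abs]
    positivity
  · rw [hf.deriv_fEps]
    have : 0 < deriv f (x / ε) := by
      apply hf.deriv_pos
      rw [mem_Icc, ← abs_le, abs_div, abs_of_pos hε]
      exact div_le_one_of_le₀ h hε.le
    positivity

end DesingFunction

/-! ### Pointwise linear algebra of the model form -/

section ModelForm

variable {F : Type*} [NormedAddCommGroup F] [NormedSpace ℝ F]
  {S : Type*} [TopologicalSpace S] [ChartedSpace F S]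

/-- The 1-form `∑_{i<m} r^i αᵢ` at `s`. -/
def coeff (m : ℕ) (α : ℕ → DiffForm F S 1) (r : ℝ) (s : S) : F →L[ℝ] ℝ :=
  ∑ i ∈ Finset.range m, r ^ i • covec ((α i).fiber s)

theorem modelForm_apply (m : ℕ) (α : ℕ → DiffForm F S 1) (β : DiffForm F S 2) (φ : ℝ → ℝ)
    (r : ℝ) (s : S) (u v : ℝ × F) :
    modelForm m α β φ (r, s) ![u, v] =
      φ r * (u.1 * coeff m α r s v.2 - v.1 * coeff m α r s u.2) +
        β.fiber s ![u.2, v.2] := by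
  have h1 : modelForm m α β φ (r, s) ![u, v] = φ r * wedge (ContinuousLinearMap.fst ℝ ℝ F)
      ((coeff m α r s).comp (ContinuousLinearMap.snd ℝ ℝ F)) ![u, v] +
      (β.fiber s).compContinuousLinearMap
      (ContinuousLinearMap.snd ℝ ℝ F) ![u, v] := rfl
  rw [h1, wedge_apply, comp_pair]
  rfl

theorem coeff_zero {m : ℕ} (hm : 0 < m) (α : ℕ → DiffForm F S 1) (s : S) :
    coeff m α 0 s = covec ((α 0).fiber s) := by
  obtain ⟨k, rfl⟩ : ∃ k, m = k + 1 := ⟨m - 1, by omega⟩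
  simp [coeff, Finset.sum_range_succ']

/-- Nondegeneracy of `dr ∧ ∑_{i<m} r^i αᵢ + β`. -/
def ModelNondeg (m : ℕ) (α : ℕ → DiffForm F S 1) (β : DiffForm F S 2) (r : ℝ) (s : S) : Prop :=
  ∀ (x : ℝ) (w : F), coeff m α r s w = 0 →
    (∀ v, x * coeff m α r s v + β.fiber s ![w, v] = 0) → x = 0 ∧ w = 0

variable {m : ℕ} {α : ℕ → DiffForm F S 1} {β : DiffForm F S 2} {r : ℝ} {s : S}

theorem modelForm_eq_zero_iff {φ : ℝ → ℝ} (hφ : φ r ≠ 0) (u : ℝ × F) :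
    (∀ v, modelForm m α β φ (r, s) ![u, v] = 0) ↔ coeff m α r s u.2 = 0 ∧
      ∀ v, (φ r * u.1) * coeff m α r s v + β.fiber s ![u.2, v] = 0 := by
  have h0 : β.fiber s ![u.2, 0] = 0 :=
    (β.fiber s).map_coord_zero (1 : Fin 2) rfl
  simp only [modelForm_apply]
  constructor
  · intro h
    have h1 : coeff m α r s u.2 = 0 := by
      have := h (1, 0)
      simp only [map_zero, h0] at this
      simpa [hφ] using this
    refine ⟨h1, fun v => ?_⟩
    have := h (0, v)
    simp only [h1] at this
    linear_combination this
  · rintro ⟨h1, h2⟩ v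
    rw [h1]
    linear_combination h2 v.2

/-- Multiplying the first coordinate by `φ r` maps the kernel of the model form onto the solutions
in `ModelNondeg`, where `φ` does not occur. So nondegeneracy passes from `r^{-2m}` to `f_ε'`. -/
theorem modelNondeg_iff {φ : ℝ → ℝ} (hφ : φ r ≠ 0) : ModelNondeg m α β r s ↔
    ∀ u, (∀ v, modelForm m α β φ (r, s) ![u, v] = 0) → u = 0 := by
  simp only [modelForm_eq_zero_iff hφ]
  constructor
  · rintro h ⟨x, w⟩ ⟨h1, h2⟩
    obtain ⟨h3, h4⟩ := h _ w h1 h2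
    exact Prod.ext ((mul_eq_zero.1 h3).resolve_left hφ) h4
  · intro h x w h1 h2
    have := h ((φ r)⁻¹ * x, w) ⟨h1, fun v => by rw [mul_inv_cancel_left₀ hφ]; exact h2 v⟩
    rw [Prod.mk_eq_zero] at this
    exact ⟨by simpa [hφ] using this.1, this.2⟩

/-- Existence of the Reeb vector. -/
theorem exists_reeb [FiniteDimensional ℝ F] (hm : 0 < m) (h : ModelNondeg m α β 0 s) :
    ∃ R : F, IsReebAt (α 0) β s R := by
  -- The Reeb vector is obtained as the Hamiltonian vector of the function `r` for `dr ∧ α₀ + β`.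
  -- Testing on `(1, 0)` gives `α₀(R) = 1`, and testing on `(0, R)` shows that it has no radial
  -- component.
  rw [modelNondeg_iff (φ := fun _ => 1) one_ne_zero] at h
  obtain ⟨⟨x, R⟩, hR⟩ := (pairing_isInvertible h).surjective (- ContinuousLinearMap.fst ℝ ℝ F)
  have hR' : ∀ v : ℝ × F, (x * coeff m α 0 s v.2 - v.1 * coeff m α 0 s R) +
      β.fiber s ![R, v.2] = - v.1 := by
    intro v
    have := DFunLike.congr_fun hR v
    rw [pairing_apply, modelForm_apply] at this
    simpa using this
  have hβR : β.fiber s ![R, R] = 0 := by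
    have := form_swap (β.fiber s) R R
    linarith
  have h0 : β.fiber s ![R, 0] = 0 :=
    (β.fiber s).map_coord_zero (1 : Fin 2) rfl
  have h1 : coeff m α 0 s R = 1 := by
    have := hR' (1, 0)
    simp only [map_zero, h0] at this
    linarith
  have hx : x = 0 := by
    have := hR' (0, R)
    simp only [h1, hβR] at this
    linarith
  refine ⟨R, ?_, fun v => ?_⟩
  · rw [coeff_zero hm] at h1
    exact h1
  · have := hR' (0, v)
    simp only [hx] at this
    change β.fiber s ![R, v] = 0
    linarith

/-- The Hamiltonian vector of a covector that vanishes on the Reeb vector is tangent to the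
levels of `r`. -/
theorem modelForm_hamiltonian {φ : ℝ → ℝ} (hφ : φ r ≠ 0) (h : ModelNondeg m α β r s)
    {R : F} (hR : IsReebAt (α 0) β s R) {g : F →L[ℝ] ℝ} (hg : g R = 0) {k : ℝ} {u : ℝ × F}
    (hu : ∀ v : ℝ × F, modelForm m α β φ (r, s) ![u, v] = - (v.1 * (φ r * k) + g v.2)) :
    u.1 = 0 ∧ coeff m α r s u.2 = k ∧
      ∀ v, β.fiber s ![u.2, v] = - g v := by
  have h0 : β.fiber s ![u.2, 0] = 0 :=
    (β.fiber s).map_coord_zero (1 : Fin 2) rfl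
  have hβR : ∀ v, β.fiber s ![R, v] = 0 := hR.2
  -- `R` is normalized by `α₀`, not by `A_r`. Still `A_r(R) ≠ 0`: otherwise `(0, R)` would lie in
  -- the kernel of the model form at level `r`.
  have hR0 : coeff m α r s R ≠ 0 := by
    intro h1
    have h2 := (h 0 R h1 fun v => by rw [hβR]; ring).2
    have h3 : covec ((α 0).fiber s) R = 1 := hR.1
    rw [h2] at h3
    have : covec ((α 0).fiber s) (0 : F) = 0 := map_zero (covec ((α 0).fiber s) : F →L[ℝ] ℝ)
    exact zero_ne_one (this.symm.trans h3)
  simp only [modelForm_apply] at hu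
  have h1 : coeff m α r s u.2 = k := by
    have := hu (1, 0)
    simp only [map_zero, h0] at this
    have : φ r * (coeff m α r s u.2 - k) = 0 := by linear_combination - this
    linarith [(mul_eq_zero.1 this).resolve_left hφ]
  have h2 : u.1 = 0 := by
    have := hu (0, R)
    simp only [hg] at this
    rw [form_swap, hβR] at this
    have : (φ r * coeff m α r s R) * u.1 = 0 := by linear_combination this
    exact (mul_eq_zero.1 this).resolve_left (mul_ne_zero hφ hR0)
  refine ⟨h2, h1, fun v => ?_⟩
  have := hu (0, v)
  simp only [h2] at this
  linear_combination this

end ModelForm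

/-! ### Topology of the tube, the desingularization in it, and nondegeneracy up to `Z` -/

section Tube

variable {E : Type*} [NormedAddCommGroup E] [NormedSpace ℝ E]
  {M : Type*} [TopologicalSpace M] [ChartedSpace E M]
  {F : Type*} [NormedAddCommGroup F] [NormedSpace ℝ F]
  {S : Type*} [TopologicalSpace S] [ChartedSpace F S]
  {ι : S → M} {z : M → ℝ} (T : TubularNhd E F ι z)

theorem dChartSymm_self [IsManifold 𝓘(ℝ, E) ∞ M] (p : M) :
    dChartSymm p (extChartAt 𝓘(ℝ, E) p p) = ContinuousLinearMap.id ℝ E := by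
  have : IsManifold 𝓘(ℝ, E) 1 M := IsManifold.of_le (n := ∞) (by simp)
  have := mfderivWithin_range_extChartAt_symm (I := 𝓘(ℝ, E)) (x := p)
  rwa [modelWithCornersSelf_coe, range_id, mfderivWithin_univ] at this

theorem TubularNhd.dCoord_self [IsManifold 𝓘(ℝ, F) ∞ S] (r : ℝ) (s : S) :
    T.dCoord s (r, extChartAt 𝓘(ℝ, F) s s) = T.dΨ (r, s) := by
  refine ContinuousLinearMap.ext fun u => ?_
  rw [T.dCoord_apply, dChartSymm_self, extChartAt_to_inv]
  rfl

theorem TubularNhd.Ψ_mem_range_iff {r : ℝ} (hr : r ∈ Ioo (-T.δ) T.δ) (s : S) :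
    T.Ψ (r, s) ∈ range ι ↔ r = 0 := by
  constructor
  · rintro ⟨s', hs'⟩
    rw [← T.zero_section] at hs'
    have := T.injOn (x₁ := (0, s')) ⟨⟨by linarith [T.δ_pos], T.δ_pos⟩, mem_univ _⟩
      (x₂ := (r, s)) ⟨hr, mem_univ _⟩ hs'
    exact (Prod.ext_iff.1 this).1.symm
  · rintro rfl
    exact ⟨s, (T.zero_section s).symm⟩

theorem TubularNhd.zero_mem : (0 : ℝ) ∈ Ioo (-T.δ) T.δ := ⟨by linarith [T.δ_pos], T.δ_pos⟩

theorem TubularNhd.mem_nhd_iff {r ε : ℝ} (hr : r ∈ Ioo (-T.δ) T.δ) (hε : ε ≤ T.δ) (s : S) :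
    T.Ψ (r, s) ∈ T.nhd ε ↔ r ∈ Ioo (-ε) ε := by
  constructor
  · rintro ⟨⟨r', s'⟩, ⟨hr', -⟩, hq⟩
    have := T.injOn (x₁ := (r', s')) ⟨⟨by linarith [hr'.1], by linarith [hr'.2]⟩, mem_univ _⟩
      (x₂ := (r, s)) ⟨hr, mem_univ _⟩ hq
    have h : r' = r := (Prod.ext_iff.1 this).1
    exact h ▸ hr'
  · exact fun h => ⟨(r, s), ⟨h, mem_univ _⟩, rfl⟩

theorem TubularNhd.isOpen_nhd {ε : ℝ} (hε : ε ≤ T.δ) : IsOpen (T.nhd ε) := by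
  rw [isOpen_iff_mem_nhds]
  rintro _ ⟨⟨r, s⟩, ⟨hr, -⟩, rfl⟩
  obtain ⟨Φ, hq, hΦ⟩ := T.isLocalDiffeomorphOn
    ⟨(r, s), ⟨by linarith [hr.1], by linarith [hr.2]⟩, mem_univ _⟩
  have h1 : (Φ.toOpenPartialHomeomorph : ℝ × S → M) (r, s) = T.Ψ (r, s) := (hΦ hq).symm
  have h2 : T.Ψ '' (Φ.source ∩ Ioo (-ε) ε ×ˢ univ) ∈ 𝓝 (T.Ψ (r, s)) := by
    have h3 : T.Ψ '' (Φ.source ∩ Ioo (-ε) ε ×ˢ univ) =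
        Φ.toOpenPartialHomeomorph '' (Φ.source ∩ Ioo (-ε) ε ×ˢ univ) :=
      image_congr fun x hx => hΦ hx.1
    rw [h3, ← h1]
    refine Φ.toOpenPartialHomeomorph.image_mem_nhds hq ?_
    exact (Φ.open_source.inter (isOpen_Ioo.prod isOpen_univ)).mem_nhds ⟨hq, hr, mem_univ _⟩
  exact Filter.mem_of_superset h2 (image_mono inter_subset_right)

theorem TubularNhd.isClosed_image [T2Space M] [CompactSpace S] {ε : ℝ} (hε : ε < T.δ) :
    IsClosed (T.Ψ '' (Icc (-ε) ε ×ˢ univ)) := by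
  refine ((isCompact_Icc.prod isCompact_univ).image_of_continuousOn ?_).isClosed
  refine T.isLocalDiffeomorphOn.contMDiffOn.continuousOn.mono (prod_mono ?_ subset_rfl)
  exact fun x hx => ⟨by linarith [hx.1], by linarith [hx.2]⟩

/-- The open tube and the complement of the closed `ε`-tube cover `M` with overlap. On the first the
desingularization is a model form, on the second it is `Ω`, so no separate argument is needed at
`|z| = ε`. -/
theorem mem_tube_or_notMem {ε : ℝ} (hεT : ε < T.δ) (p : M) :
    (∃ r ∈ Ioo (-T.δ) T.δ, ∃ s, T.Ψ (r, s) = p) ∨ p ∉ T.Ψ '' (Icc (-ε) ε ×ˢ univ) := by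
  by_cases hp : p ∈ T.Ψ '' (Icc (-ε) ε ×ˢ univ)
  · obtain ⟨⟨r, s⟩, ⟨hr, -⟩, rfl⟩ := hp
    exact Or.inl ⟨r, ⟨by linarith [hr.1], by linarith [hr.2]⟩, s, rfl⟩
  · exact Or.inr hp

theorem TubularNhd.range_subset {ε : ℝ} (hε : 0 < ε) :
    range ι ⊆ T.Ψ '' (Icc (-ε) ε ×ˢ univ) := by
  rintro _ ⟨s, rfl⟩
  exact ⟨(0, s), ⟨⟨by linarith, hε.le⟩, mem_univ _⟩, T.zero_section s⟩

section Desing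

variable {m : ℕ} {Ω : DiffForm E M 2} {α : ℕ → DiffForm F S 1} {β : DiffForm F S 2}
  {f : ℝ → ℝ} {ε : ℝ}

theorem desing_of_notMem {p : M} (hp : p ∉ T.nhd ε) : desing T m Ω α β f ε p = Ω p :=
  dif_neg hp

theorem IsDecomposition.apply (hT : IsDecomposition T m Ω α β) {r : ℝ}
    (hr : r ∈ Ioo (-T.δ) T.δ) (h0 : r ≠ 0) (s : S) (u v : ℝ × F) :
    Ω.fiber (T.Ψ (r, s)) ![T.dΨ (r, s) u, T.dΨ (r, s) v] =
      modelForm m α β (fun x => (x ^ m)⁻¹) (r, s) ![u, v] := by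
  rw [← hT.eq r hr h0 s]
  exact (comp_pair (Ω.fiber (T.Ψ (r, s))) (T.dΨ (r, s)) u v).symm

/-- In the whole tubular neighbourhood, the desingularization is `d f_ε ∧ ∑ r^i αᵢ + β`. -/
theorem desing_apply (hm : 1 ≤ m) (hT : IsDecomposition T (2 * m) Ω α β)
    (hf : IsDesingFunction m f) (hε : 0 < ε) (hεT : ε ≤ T.δ) {r : ℝ} (hr : r ∈ Ioo (-T.δ) T.δ)
    (s : S) (u v : ℝ × F) :
    (desing T m Ω α β f ε).fiber (T.Ψ (r, s)) ![T.dΨ (r, s) u, T.dΨ (r, s) v] =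
      modelForm (2 * m) α β (deriv (fEps m f ε)) (r, s) ![u, v] := by
  by_cases h : T.Ψ (r, s) ∈ T.nhd ε
  · have hq : h.choose = (r, s) := by
      obtain ⟨h1, h2⟩ := h.choose_spec
      refine T.injOn ⟨⟨?_, ?_⟩, mem_univ _⟩ ⟨hr, mem_univ _⟩ h2
      · linarith [h1.1.1]
      · linarith [h1.1.2]
    have h3 : (desing T m Ω α β f ε).fiber (T.Ψ (r, s)) =
        (modelForm (2 * m) α β (deriv (fEps m f ε)) h.choose).compContinuousLinearMap
          (T.dΨ h.choose).inverse := dif_pos h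
    rw [h3, hq, comp_pair, (T.dΨ_isInvertible (q := (r, s)) hr).inverse_apply_self,
      (T.dΨ_isInvertible (q := (r, s)) hr).inverse_apply_self]
  · have h3 : (desing T m Ω α β f ε).fiber (T.Ψ (r, s)) = Ω.fiber (T.Ψ (r, s)) :=
      desing_of_notMem T h
    rw [T.mem_nhd_iff hr hεT, mem_Ioo, ← abs_lt, not_lt] at h
    have h0 : r ≠ 0 := abs_pos.1 (hε.trans_le h)
    rw [h3, hT.apply T hr h0, modelForm_apply, modelForm_apply, hf.deriv_fEps_of_le hm hε h]

end Desing

section Nondeg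

variable [IsManifold 𝓘(ℝ, E) ∞ M] [IsManifold 𝓘(ℝ, F) ∞ S]

/-- The restriction of a smooth covector field to a coordinate curve is continuous. -/
theorem TubularNhd.continuousAt_coord_covec {μ : DiffForm E M 1} {r₀ : ℝ} {s : S}
    (hr : r₀ ∈ Ioo (-T.δ) T.δ) (hμ : SmoothFormAt μ (T.Ψ (r₀, s))) (u : ℝ × F) :
    ContinuousAt (fun r => covec (μ.fiber (T.Ψ (r, s))) (T.dΨ (r, s) u)) r₀ := by
  have hs := T.eventually_mem_source (s₀ := s) hr
  have h0 := hs.self_of_nhds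
  have hG := T.contDiffAt_transition h0.1 h0.2
  have hμ' : ContDiffAt ℝ ∞ (chartRep μ (T.Ψ (r₀, s)))
      (T.transition s (T.Ψ (r₀, s)) (r₀, extChartAt 𝓘(ℝ, F) s s)) := by
    rwa [T.transition_self]
  have h1 : ContDiffAt ℝ ∞ (fun y : ℝ × F => covec (chartRep μ (T.Ψ (r₀, s))
      (T.transition s (T.Ψ (r₀, s)) y)) (fderiv ℝ (T.transition s (T.Ψ (r₀, s))) y u))
      (r₀, extChartAt 𝓘(ℝ, F) s s) := by
    refine ContDiffAt.clm_apply ?_ ((hG.fderiv_right (m := ∞) (by simp)).clm_apply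
      contDiffAt_const)
    exact contDiff_covec.contDiffAt.comp _ (hμ'.comp _ hG)
  have h2 : Filter.Tendsto (fun r : ℝ => (r, extChartAt 𝓘(ℝ, F) s s)) (𝓝 r₀)
      (𝓝 (r₀, extChartAt 𝓘(ℝ, F) s s)) := by
    rw [nhds_prod_eq]
    exact Filter.tendsto_id.prodMk tendsto_const_nhds
  have h3 := ContinuousAt.comp (f := fun r : ℝ => (r, extChartAt 𝓘(ℝ, F) s s)) (x := r₀)
    h1.continuousAt h2
  refine h3.congr ?_
  filter_upwards [h2.eventually hs] with r hy
  rw [Function.comp_apply, covec_apply, covec_apply]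
  have h4 := T.dChartSymm_fderiv_transition hy.1 hy.2 u
  rw [T.dCoord_self] at h4
  rw [← h4]
  have h5 := T.chartSymm_transition hy.2
  rw [T.coord_self] at h5
  have h6 : chartRep μ (T.Ψ (r₀, s)) (T.transition s (T.Ψ (r₀, s)) (r, extChartAt 𝓘(ℝ, F) s s)) =
    (μ.fiber (T.Ψ (r, s))).compContinuousLinearMap (dChartSymm (T.Ψ (r₀, s))
      (T.transition s (T.Ψ (r₀, s)) (r, extChartAt 𝓘(ℝ, F) s s))) := by
    rw [← h5]
    rfl
  rw [h6, ContinuousAlternatingMap.compContinuousLinearMap_apply]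
  congr 1
  ext i
  fin_cases i
  rfl

/-- The restriction of a smooth 2-form to a coordinate curve is continuous. -/
theorem TubularNhd.continuousAt_coord_form {ν : DiffForm E M 2} {r₀ : ℝ} {s : S}
    (hr : r₀ ∈ Ioo (-T.δ) T.δ) (hν : SmoothFormAt ν (T.Ψ (r₀, s))) (u v : ℝ × F) :
    ContinuousAt (fun r => ν.fiber (T.Ψ (r, s)) ![T.dΨ (r, s) u, T.dΨ (r, s) v]) r₀ := by
  have hs := T.eventually_mem_source (s₀ := s) hr
  have h0 := hs.self_of_nhds
  have hG := T.contDiffAt_transition h0.1 h0.2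
  have hD := (hG.fderiv_right (m := ∞) (by simp))
  have hν' : ContDiffAt ℝ ∞ (chartRep ν (T.Ψ (r₀, s)))
      (T.transition s (T.Ψ (r₀, s)) (r₀, extChartAt 𝓘(ℝ, F) s s)) := by
    rwa [T.transition_self]
  have h1 : ContDiffAt ℝ ∞ (fun y : ℝ × F => pairing E (chartRep ν (T.Ψ (r₀, s))
      (T.transition s (T.Ψ (r₀, s)) y)) (fderiv ℝ (T.transition s (T.Ψ (r₀, s))) y u)
      (fderiv ℝ (T.transition s (T.Ψ (r₀, s))) y v)) (r₀, extChartAt 𝓘(ℝ, F) s s) := by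
    refine ContDiffAt.clm_apply (ContDiffAt.clm_apply ?_ (hD.clm_apply contDiffAt_const))
      (hD.clm_apply contDiffAt_const)
    exact contDiff_pairing.contDiffAt.comp _ (hν'.comp _ hG)
  have h2 : Filter.Tendsto (fun r : ℝ => (r, extChartAt 𝓘(ℝ, F) s s)) (𝓝 r₀)
      (𝓝 (r₀, extChartAt 𝓘(ℝ, F) s s)) := by
    rw [nhds_prod_eq]
    exact Filter.tendsto_id.prodMk tendsto_const_nhds
  have h3 := ContinuousAt.comp (f := fun r : ℝ => (r, extChartAt 𝓘(ℝ, F) s s)) (x := r₀)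
    h1.continuousAt h2
  refine h3.congr ?_
  filter_upwards [h2.eventually hs] with r hy
  rw [Function.comp_apply, pairing_apply, T.chartRep_transition ν hy.1 hy.2, T.coord_self,
    T.dCoord_self]

variable {m : ℕ} {Ω : DiffForm E M 2} {α : ℕ → DiffForm F S 1} {β : DiffForm F S 2}

omit [IsManifold 𝓘(ℝ, E) ∞ M] [IsManifold 𝓘(ℝ, F) ∞ S] in
theorem modelNondeg_of_ne_zero (hΩ : IsBSymplectic m (range ι) z Ω)
    (hT : IsDecomposition T m Ω α β) {r : ℝ} (hr : r ∈ Ioo (-T.δ) T.δ) (h0 : r ≠ 0) (s : S) :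
    ModelNondeg m α β r s := by
  rw [modelNondeg_iff (φ := fun x => (x ^ m)⁻¹) (inv_ne_zero (pow_ne_zero m h0))]
  intro u hu
  have hi := T.dΨ_isInvertible (q := (r, s)) hr
  apply hi.injective
  rw [map_zero]
  refine hΩ.nondeg (T.Ψ (r, s)) (by rwa [T.Ψ_mem_range_iff hr]) _ fun v => ?_
  obtain ⟨v, rfl⟩ := hi.surjective v
  exact (hT.apply T hr h0 s u v).trans (hu v)

omit [IsManifold 𝓘(ℝ, E) ∞ M] in
/-- The defining function is the first coordinate of the tubular neighbourhood. -/
theorem TubularNhd.dAt_z {r : ℝ} {s : S} (hr : r ∈ Ioo (-T.δ) T.δ)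
    (hz : MDifferentiableAt 𝓘(ℝ, E) 𝓘(ℝ, ℝ) z (T.Ψ (r, s))) (u : ℝ × F) :
    (dAt (E := E) z (T.Ψ (r, s)) : E →L[ℝ] ℝ) (T.dΨ (r, s) u) = u.1 := by
  have h1 := T.fderiv_comp_coord (T.mem_coordDomain hr s) (K := z) (by rwa [T.coord_self]) u
  rw [T.coord_self, T.dCoord_self] at h1
  refine h1.symm.trans ?_
  have h2 : z ∘ T.coord s =ᶠ[𝓝 (r, extChartAt 𝓘(ℝ, F) s s)] Prod.fst := by
    filter_upwards [(T.isOpen_coordDomain s).mem_nhds (T.mem_coordDomain hr s)] with y hy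
    exact T.z_Ψ _ hy.1 _
  rw [h2.fderiv_eq, fderiv_fst]
  rfl

/-- Comparing the two expressions of `Ω` as `r → 0` gives `α₀ = μ` and `β = ν` on `ker dz`, so the
condition at `r = 0` is exactly nondegeneracy on the `b`-tangent space. -/
theorem modelNondeg_zero (hm : 0 < m) (hz : IsLocalDefiningFunction E (range ι) z)
    (hΩ : IsBSymplectic m (range ι) z Ω) (hT : IsDecomposition T m Ω α β) (s : S) :
    ModelNondeg m α β 0 s := by
  obtain ⟨Uz, hUz, hZU, hzs, -, -⟩ := hz
  have hp : T.Ψ (0, s) ∈ range ι := (T.Ψ_mem_range_iff T.zero_mem s).2 rfl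
  obtain ⟨U, hU, hpU, μ, ν, hsm, hΩU, hnd⟩ := hΩ.near _ hp
  have hc : ContinuousAt (fun r => T.Ψ (r, s)) 0 :=
    ContinuousAt.comp (f := fun r : ℝ => (r, s)) (T.contMDiffAt_Ψ (q := (0, s))
      T.zero_mem).continuousAt (by fun_prop)
  have hmd : ∀ q ∈ Uz, MDifferentiableAt 𝓘(ℝ, E) 𝓘(ℝ, ℝ) z q := fun q hq =>
    (hzs.contMDiffAt (hUz.mem_nhds hq)).mdifferentiableAt (by simp)
  have hne : ∀ᶠ r in 𝓝[≠] (0 : ℝ), ∀ u v : ℝ × F,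
      (r ^ m)⁻¹ * (u.1 * coeff m α r s v.2 - v.1 * coeff m α r s u.2) + β.fiber s ![u.2, v.2] =
      (r ^ m)⁻¹ * (u.1 * covec (μ.fiber (T.Ψ (r, s))) (T.dΨ (r, s) v) -
        v.1 * covec (μ.fiber (T.Ψ (r, s))) (T.dΨ (r, s) u)) +
        ν.fiber (T.Ψ (r, s)) ![T.dΨ (r, s) u, T.dΨ (r, s) v] := by
    filter_upwards [self_mem_nhdsWithin, nhdsWithin_le_nhds (hc.eventually_mem (hU.mem_nhds hpU)),
      nhdsWithin_le_nhds (hc.eventually_mem (hUz.mem_nhds (hZU hp))),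
      nhdsWithin_le_nhds (isOpen_Ioo.mem_nhds T.zero_mem)] with r hr0 hrU hrz hr u v
    have h1 := hT.apply T hr hr0 s u v
    rw [modelForm_apply] at h1
    rw [← h1]
    have h2 := hΩU _ hrU (by rwa [T.Ψ_mem_range_iff hr])
    have h4 : Ω.fiber (T.Ψ (r, s)) ![T.dΨ (r, s) u, T.dΨ (r, s) v] = (z (T.Ψ (r, s)) ^ m)⁻¹ *
      wedge (dAt (E := E) z (T.Ψ (r, s)) : E →L[ℝ] ℝ) (covec (μ.fiber (T.Ψ (r, s))))
        ![T.dΨ (r, s) u, T.dΨ (r, s) v] +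
        ν.fiber (T.Ψ (r, s)) ![T.dΨ (r, s) u, T.dΨ (r, s) v] :=
      congrArg (fun a : E [⋀^Fin 2]→L[ℝ] ℝ => a ![T.dΨ (r, s) u, T.dΨ (r, s) v]) h2
    have h5 := T.dAt_z hr (hmd _ hrz)
    rw [h4, wedge_apply, T.z_Ψ r hr]
    rw [← h5 u, ← h5 v]
    rfl
  have hμc := fun u => (T.continuousAt_coord_covec T.zero_mem (hsm _ hpU).1 u).tendsto.mono_left
    (nhdsWithin_le_nhds (s := {0}ᶜ))
  have hνc := fun u v => (T.continuousAt_coord_form T.zero_mem (hsm _ hpU).2 u v).tendsto.mono_left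
    (nhdsWithin_le_nhds (s := {0}ᶜ))
  -- On vectors tangent to the levels of `z` the singular terms of both expressions vanish, so the
  -- limit can be taken directly.
  have hβ : ∀ u v : F, β.fiber s ![u, v] =
      ν.fiber (T.Ψ (0, s)) ![T.dΨ (0, s) (0, u), T.dΨ (0, s) (0, v)] := by
    intro u v
    refine tendsto_nhds_unique (tendsto_const_nhds.congr' ?_) (hνc (0, u) (0, v))
    filter_upwards [hne] with r hr
    have := hr (0, u) (0, v)
    simpa using this
  have hα : ∀ v : F, coeff m α 0 s v = covec (μ.fiber (T.Ψ (0, s))) (T.dΨ (0, s) (0, v)) := by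
    intro v
    have h1 : Filter.Tendsto (fun r => coeff m α r s v) (𝓝[≠] 0) (𝓝 (coeff m α 0 s v)) := by
      refine Filter.Tendsto.mono_left (Continuous.tendsto ?_ 0) nhdsWithin_le_nhds
      simp only [coeff, sum_apply, smul_apply]
      fun_prop
    have h2 : Filter.Tendsto (fun r : ℝ => r ^ m) (𝓝[≠] 0) (𝓝 0) := by
      have := (continuous_pow m).tendsto (0 : ℝ)
      rw [zero_pow hm.ne'] at this
      exact this.mono_left nhdsWithin_le_nhds
    -- On the pair `(1, 0)`, `(0, v)` the comparison is multiplied by `r^m`; this leaves `A_r(v) =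
    -- μ(v) + r^m ν`, whose last term tends to `0`.
    have h3 := (hμc (0, v)).add (h2.mul (hνc (1, 0) (0, v)))
    rw [zero_mul, add_zero] at h3
    refine tendsto_nhds_unique (h1.congr' ?_) h3
    filter_upwards [hne, self_mem_nhdsWithin] with r hr hr0
    have h4 := hr (1, 0) (0, v)
    have h5 : β.fiber s ![0, v] = 0 := (β.fiber s).map_coord_zero (0 : Fin 2) rfl
    have h6 : r ^ m ≠ 0 := pow_ne_zero m hr0
    simp only [h5, zero_mul, one_mul, sub_zero, add_zero] at h4
    field_simp at h4
    linarith
  intro x w hw h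
  have hi := T.dΨ_isInvertible (q := (0, s)) T.zero_mem
  have hz0 := T.dAt_z T.zero_mem (hmd _ (hZU hp))
  have h1 := hnd x (T.dΨ (0, s) (0, w)) (hz0 (0, w)) fun b v hv => ?_
  · refine ⟨h1.1, ?_⟩
    have := hi.injective (h1.2.trans (map_zero (T.dΨ (0, s))).symm)
    exact (Prod.ext_iff.1 this).2
  · obtain ⟨⟨a, v⟩, rfl⟩ := hi.surjective v
    have ha : a = 0 := (hz0 (a, v)).symm.trans hv
    subst ha
    change x * covec (μ.fiber (T.Ψ (0, s))) (T.dΨ (0, s) (0, v)) -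
      b * covec (μ.fiber (T.Ψ (0, s))) (T.dΨ (0, s) (0, w)) +
      ν.fiber (T.Ψ (0, s)) ![T.dΨ (0, s) (0, w), T.dΨ (0, s) (0, v)] = 0
    rw [← hα, ← hα, ← hβ, hw, mul_zero, sub_zero]
    exact h v

theorem modelNondeg (hm : 0 < m) (hz : IsLocalDefiningFunction E (range ι) z)
    (hΩ : IsBSymplectic m (range ι) z Ω) (hT : IsDecomposition T m Ω α β) {r : ℝ}
    (hr : r ∈ Ioo (-T.δ) T.δ) (s : S) : ModelNondeg m α β r s := by
  rcases eq_or_ne r 0 with rfl | h0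
  · exact modelNondeg_zero T hm hz hΩ hT s
  · exact modelNondeg_of_ne_zero T hΩ hT hr h0 s

end Nondeg

end Tube

/-! ### The desingularization is symplectic -/

section DesingSymplectic

variable {F : Type*} [NormedAddCommGroup F] [NormedSpace ℝ F]
  {S : Type*} [TopologicalSpace S] [ChartedSpace F S]

theorem covec_chartRep (μ : DiffForm F S 1) (s₀ : S) (x w : F) :
    covec (chartRep μ s₀ x) w =
      covec (μ.fiber ((extChartAt 𝓘(ℝ, F) s₀).symm x)) (dChartSymm s₀ x w) := by
  have h : chartRep μ s₀ x = (μ.fiber ((extChartAt 𝓘(ℝ, F) s₀).symm x)).compContinuousLinearMap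
    (dChartSymm s₀ x) := rfl
  rw [covec_apply, covec_apply, h, ContinuousAlternatingMap.compContinuousLinearMap_apply]
  congr 1
  ext i
  fin_cases i
  rfl

/-- The model form written in the chart at `s₀`. -/
def modelRep (m : ℕ) (α : ℕ → DiffForm F S 1) (β : DiffForm F S 2) (φ : ℝ → ℝ) (s₀ : S)
    (y : ℝ × F) : (ℝ × F) [⋀^Fin 2]→L[ℝ] ℝ :=
  (modelForm m α β φ (y.1, (extChartAt 𝓘(ℝ, F) s₀).symm y.2)).compContinuousLinearMap
    ((ContinuousLinearMap.id ℝ ℝ).prodMap (dChartSymm s₀ y.2))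

theorem modelRep_apply (m : ℕ) (α : ℕ → DiffForm F S 1) (β : DiffForm F S 2) (φ : ℝ → ℝ)
    (s₀ : S) (y v w : ℝ × F) : modelRep m α β φ s₀ y ![v, w] =
      v.1 * (φ y.1 • ∑ i ∈ Finset.range m, y.1 ^ i • covec (chartRep (α i) s₀ y.2)) w.2 -
      w.1 * (φ y.1 • ∑ i ∈ Finset.range m, y.1 ^ i • covec (chartRep (α i) s₀ y.2)) v.2 +
      chartRep β s₀ y.2 ![v.2, w.2] := by
  have h : ∀ u : F, coeff m α y.1 ((extChartAt 𝓘(ℝ, F) s₀).symm y.2) (dChartSymm s₀ y.2 u) =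
      (∑ i ∈ Finset.range m, y.1 ^ i • covec (chartRep (α i) s₀ y.2)) u := by
    intro u
    simp only [coeff, sum_apply, smul_apply, covec_chartRep]
  rw [modelRep, comp_pair, modelForm_apply, chartRep_apply_pair, smul_apply, smul_apply, ← h, ← h]
  simp only [ContinuousLinearMap.coe_prodMap', Prod.map, ContinuousLinearMap.id_apply, smul_eq_mul]
  ring

variable [IsManifold 𝓘(ℝ, F) ∞ S] [FiniteDimensional ℝ F]
  {E : Type*} [NormedAddCommGroup E] [NormedSpace ℝ E] [FiniteDimensional ℝ E]
  {M : Type*} [TopologicalSpace M] [ChartedSpace E M] [IsManifold 𝓘(ℝ, E) ∞ M]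
  {ι : S → M} {z : M → ℝ} {T : TubularNhd E F ι z}
  {m : ℕ} {Ω : DiffForm E M 2} {α : ℕ → DiffForm F S 1} {β : DiffForm F S 2}
  {f : ℝ → ℝ} {ε : ℝ}

omit [FiniteDimensional ℝ E] [IsManifold 𝓘(ℝ, E) ∞ M] in
theorem IsDecomposition.smooth_closed_modelRep (hT : IsDecomposition T m Ω α β) {φ : ℝ → ℝ}
    {r₀ : ℝ} (hφ : ContDiffAt ℝ ∞ φ r₀) (s₀ : S) :
    ContDiffAt ℝ ∞ (modelRep m α β φ s₀) (r₀, extChartAt 𝓘(ℝ, F) s₀ s₀) ∧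
      extDeriv (modelRep m α β φ s₀) (r₀, extChartAt 𝓘(ℝ, F) s₀ s₀) = 0 := by
  have ha : ∀ i < m, ContDiffAt ℝ ∞ (fun x => covec (chartRep (α i) s₀ x))
      (extChartAt 𝓘(ℝ, F) s₀ s₀) := fun i hi =>
    contDiff_covec.contDiffAt.comp _ (hT.smooth_α i hi s₀)
  have has : ∀ i < m, ∀ u w, fderiv ℝ (fun x => covec (chartRep (α i) s₀ x))
      (extChartAt 𝓘(ℝ, F) s₀ s₀) u w = fderiv ℝ (fun x => covec (chartRep (α i) s₀ x))
      (extChartAt 𝓘(ℝ, F) s₀ s₀) w u := fun i hi =>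
    fderiv_covec_symm (ContDiffAt.differentiableAt (hT.smooth_α i hi s₀) (by simp))
      (extD_eq_zero_iff.1 (hT.closed_α i hi s₀))
  exact ⟨contDiffAt_model hφ ha (hT.smooth_β s₀) (fun _ => rfl) (modelRep_apply m α β φ s₀),
    extDeriv_model hφ ha (hT.smooth_β s₀) has (extD_eq_zero_iff.1 (hT.closed_β s₀))
      (fun _ => rfl) (modelRep_apply m α β φ s₀)⟩

omit [IsManifold 𝓘(ℝ, F) ∞ S] [FiniteDimensional ℝ F] [FiniteDimensional ℝ E]
  [IsManifold 𝓘(ℝ, E) ∞ M] in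
/-- The desingularization agrees with `Ω` near points off the closed `ε`-tube. -/
theorem eventually_desing_eq [T2Space M] [CompactSpace S] (hεT : ε < T.δ) {p : M}
    (hp : p ∉ T.Ψ '' (Icc (-ε) ε ×ˢ univ)) :
    ∀ᶠ q in 𝓝 p, desing T m Ω α β f ε q = Ω q := by
  filter_upwards [(T.isClosed_image hεT).isOpen_compl.mem_nhds hp] with q hq
  refine desing_of_notMem T fun h => hq ?_
  exact image_mono (prod_mono Ioo_subset_Icc_self subset_rfl) h

omit [FiniteDimensional ℝ E] in
theorem smooth_closed_congr {Ω Ω' : DiffForm E M 2} {p : M} (h : ∀ᶠ q in 𝓝 p, Ω q = Ω' q)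
    (hs : SmoothFormAt Ω' p) (hc : extD Ω' p = 0) : SmoothFormAt Ω p ∧ extD Ω p = 0 := by
  have h1 : chartRep Ω p =ᶠ[𝓝 (extChartAt 𝓘(ℝ, E) p p)] chartRep Ω' p := by
    have hc := (contMDiffAt_chartSymm (mem_extChartAt_target (I := 𝓘(ℝ, E)) p)).continuousAt.tendsto
    rw [extChartAt_to_inv] at hc
    filter_upwards [hc.eventually h] with y hy
    rw [chartRep, chartRep, hy]
  rw [extD_eq_zero_iff, h1.extDeriv_eq, ← extD_eq_zero_iff]
  exact ⟨hs.congr_of_eventuallyEq h1, hc⟩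

theorem isSymplecticForm_desing [T2Space M] [CompactSpace S] (hm : 1 ≤ m)
    (hz : IsLocalDefiningFunction E (range ι) z) (hΩ : IsBSymplectic (2 * m) (range ι) z Ω)
    (hT : IsDecomposition T (2 * m) Ω α β) (hf : IsDesingFunction m f) (hε : 0 < ε)
    (hεT : ε < T.δ) : IsSymplecticForm (desing T m Ω α β f ε) := by
  have hφ : ContDiff ℝ ∞ (deriv (fEps m f ε)) :=
    (contDiff_infty_iff_deriv.1 (hf.contDiff_fEps ε)).2
  have key : ∀ p, SmoothFormAt (desing T m Ω α β f ε) p ∧ extD (desing T m Ω α β f ε) p = 0 ∧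
      NondegAt (desing T m Ω α β f ε) p := by
    intro p
    rcases mem_tube_or_notMem T hεT p with ⟨r, hr, s, rfl⟩ | hp
    · have h1 := hT.smooth_closed_modelRep (hφ.contDiffAt (x := r)) s
      have h2 := T.smoothFormAt_extD_of_coord (desing T m Ω α β f ε) hr h1.1 h1.2
        fun y hy u v => by
          rw [T.dCoord_apply, T.dCoord_apply, TubularNhd.coord,
            desing_apply T hm hT hf hε hεT.le hy.1, modelRep, comp_pair]
          rfl
      refine ⟨h2.1, h2.2, fun u hu => ?_⟩
      have hi := T.dΨ_isInvertible (q := (r, s)) hr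
      obtain ⟨u, rfl⟩ := hi.surjective u
      -- Positivity of `f_ε'` on the whole line is what keeps the form nondegenerate inside the
      -- `ε`-tube.
      have h3 := (modelNondeg_iff (hf.deriv_fEps_pos hm hε r).ne').1
        (modelNondeg T (by omega) hz hΩ hT hr s) u fun v => by
          rw [← desing_apply T hm hT hf hε hεT.le hr]
          exact hu (T.dΨ (r, s) v)
      rw [h3]
      exact map_zero (T.dΨ (r, s))
    · have hpZ : p ∉ range ι := fun h => hp (T.range_subset hε h)
      have he : ∀ᶠ q in 𝓝 p, desing T m Ω α β f ε q = Ω q := eventually_desing_eq hεT hp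
      have h1 := smooth_closed_congr he (hΩ.smooth p hpZ) (hΩ.closed p hpZ)
      refine ⟨h1.1, h1.2, ?_⟩
      have h2 := hΩ.nondeg p hpZ
      rwa [NondegAt, ← he.self_of_nhds] at h2
  exact ⟨fun p => (key p).1, fun p => (key p).2.1, fun p => (key p).2.2⟩

end DesingSymplectic

/-! ### The tangential differential of an admissible function is independent of `r` -/

section Invariance

variable {E : Type*} [NormedAddCommGroup E] [NormedSpace ℝ E]
  {M : Type*} [TopologicalSpace M] [ChartedSpace E M]
  {F : Type*} [NormedAddCommGroup F] [NormedSpace ℝ F]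
  {S : Type*} [TopologicalSpace S] [ChartedSpace F S]
  {ι : S → M} {z : M → ℝ} (T : TubularNhd E F ι z)

/-- The differential of `K ∘ Ψ`. -/
def TubularNhd.pullD (K : M → ℝ) (q : ℝ × S) : (ℝ × F) →L[ℝ] ℝ :=
  ContinuousLinearMap.comp (dAt (E := E) K (T.Ψ q) : E →L[ℝ] ℝ) (T.dΨ q)

variable [IsManifold 𝓘(ℝ, F) ∞ S] {K : M → ℝ}

theorem TubularNhd.hasFDerivAt_coord {s₀ : S} {y : ℝ × F} (hy : y ∈ T.coordDomain s₀)
    (hK : MDifferentiableAt 𝓘(ℝ, E) 𝓘(ℝ, ℝ) K (T.coord s₀ y)) :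
    HasFDerivAt (K ∘ T.coord s₀) ((T.pullD K (y.1, (extChartAt 𝓘(ℝ, F) s₀).symm y.2)).comp
      ((ContinuousLinearMap.id ℝ ℝ).prodMap (dChartSymm s₀ y.2))) y := by
  have h1 : DifferentiableAt ℝ (K ∘ T.coord s₀) y := by
    rw [← mdifferentiableAt_iff_differentiableAt]
    exact hK.comp y ((T.contMDiffAt_coord hy).mdifferentiableAt (by simp))
  refine h1.hasFDerivAt.congr_fderiv (ContinuousLinearMap.ext fun u => ?_)
  exact T.fderiv_comp_coord hy hK u

theorem TubularNhd.hasFDerivAt_slice {s₀ : S} {r : ℝ} {x : F} (hy : (r, x) ∈ T.coordDomain s₀)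
    (hK : MDifferentiableAt 𝓘(ℝ, E) 𝓘(ℝ, ℝ) K (T.coord s₀ (r, x))) :
    HasFDerivAt (fun x => K (T.coord s₀ (r, x)))
      ((T.pullD K (r, (extChartAt 𝓘(ℝ, F) s₀).symm x)).comp
        ((ContinuousLinearMap.inr ℝ ℝ F).comp (dChartSymm s₀ x))) x := by
  refine ((T.hasFDerivAt_coord hy hK).comp x (hasFDerivAt_prodMk_right r x)).congr_fderiv ?_
  ext u
  simp [ContinuousLinearMap.comp_apply]

theorem TubularNhd.hasDerivAt_radial {s : S} {r : ℝ} (hr : r ∈ Ioo (-T.δ) T.δ)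
    (hK : MDifferentiableAt 𝓘(ℝ, E) 𝓘(ℝ, ℝ) K (T.Ψ (r, s))) :
    HasDerivAt (fun r => K (T.Ψ (r, s))) (T.pullD K (r, s) (1, 0)) r := by
  have h1 := (T.hasFDerivAt_coord (T.mem_coordDomain hr s)
    (by rwa [T.coord_self])).comp_hasDerivAt r ((hasDerivAt_id r).prodMk
      (hasDerivAt_const r (extChartAt 𝓘(ℝ, F) s s)))
  have h2 : ((K ∘ T.coord s) ∘ fun r => (id r, extChartAt 𝓘(ℝ, F) s s)) =
      fun r => K (T.Ψ (r, s)) := by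
    ext r
    exact congrArg K (T.coord_self r s)
  rw [h2] at h1
  refine h1.congr_deriv ?_
  simp

variable {ρ : ℝ} {n : ℕ} {k : S → ℝ}

/-- On each side of `Z`, the tangential derivative does not depend on the distance to `Z`. -/
theorem TubularNhd.tangential_eq_of_same_side {I : Set ℝ} (hI : IsOpen I) (hI' : IsPreconnected I)
    (hIT : I ⊆ Ioo (-T.δ) T.δ) (hI0 : (0 : ℝ) ∉ I)
    (hK : ∀ p ∉ range ι, ContMDiffAt 𝓘(ℝ, E) 𝓘(ℝ, ℝ) ∞ K p) (hk : IsLocallyConstant k)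
    (hlin : ∀ r ∈ I, ∀ s, T.pullD K (r, s) (r ^ n, 0) = k s) {r r₁ : ℝ} (hr : r ∈ I)
    (hr₁ : r₁ ∈ I) (s : S) (w : F) : T.pullD K (r, s) (0, w) = T.pullD K (r₁, s) (0, w) := by
  have hne : ∀ r ∈ I, ∀ s, T.Ψ (r, s) ∉ range ι := fun r hr s => by
    rw [T.Ψ_mem_range_iff (hIT hr)]
    rintro rfl
    exact hI0 hr
  have hrad : ∀ r ∈ I, ∀ s, HasDerivAt (fun r => K (T.Ψ (r, s))) (k s / r ^ n) r := by
    intro r hr s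
    have h0 : r ^ n ≠ 0 := pow_ne_zero n fun h => hI0 (h ▸ hr)
    have h1 := T.hasDerivAt_radial (hIT hr)
      ((hK _ (hne r hr s)).mdifferentiableAt (by simp))
    refine h1.congr_deriv ?_
    have h2 := hlin r hr s
    have h3 : (r ^ n, (0 : F)) = r ^ n • ((1 : ℝ), (0 : F)) := by ext <;> simp
    rw [h3, map_smul, smul_eq_mul] at h2
    field_simp
    linarith
  -- The radial derivative of `K` is `k / r^n`, the same at `s'` and `s`, so it cancels in the
  -- difference and the connectedness of `I` applies.
  have hconst : ∀ s', k s' = k s → K (T.Ψ (r, s')) - K (T.Ψ (r, s)) =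
      K (T.Ψ (r₁, s')) - K (T.Ψ (r₁, s)) := by
    intro s' hs'
    have hd : ∀ x ∈ I, HasDerivAt (fun r => K (T.Ψ (r, s')) - K (T.Ψ (r, s))) 0 x := by
      intro x hx
      refine ((hrad x hx s').sub (hrad x hx s)).congr_deriv ?_
      rw [hs', sub_self]
    exact hI.is_const_of_deriv_eq_zero hI'
      (fun x hx => (hd x hx).differentiableAt.differentiableWithinAt)
      (fun x hx => (hd x hx).deriv) hr hr₁
  have hsl : ∀ r ∈ I, HasFDerivAt (fun x => K (T.coord s (r, x)))
      ((T.pullD K (r, s)).comp (ContinuousLinearMap.inr ℝ ℝ F)) (extChartAt 𝓘(ℝ, F) s s) := by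
    intro r hr
    have h1 := T.hasFDerivAt_slice (T.mem_coordDomain (hIT hr) s) (K := K) (by
      rw [T.coord_self]
      exact (hK _ (hne r hr s)).mdifferentiableAt (by simp))
    rw [dChartSymm_self, extChartAt_to_inv] at h1
    exact h1
  -- Since `k` is locally constant, the restrictions of `K` to the slices at `r` and `r₁` differ by
  -- a constant near `s`, and thus have equal differentials.
  have hev : (fun x => K (T.coord s (r, x)) - K (T.Ψ (r, s))) =ᶠ[𝓝 (extChartAt 𝓘(ℝ, F) s s)]
      fun x => K (T.coord s (r₁, x)) - K (T.Ψ (r₁, s)) := by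
    have hc := (contMDiffAt_chartSymm (mem_extChartAt_target (I := 𝓘(ℝ, F)) s)).continuousAt.tendsto
    rw [extChartAt_to_inv] at hc
    filter_upwards [hc.eventually (hk.eventually_eq s)] with x hx
    exact hconst _ hx
  have h2 := (((hsl r hr).sub_const _).congr_of_eventuallyEq hev.symm).unique
    ((hsl r₁ hr₁).sub_const _)
  exact DFunLike.congr_fun h2 w

/-- The tangential derivative of an admissible function does not depend on the distance to `Z`,
also across `Z`. -/
theorem TubularNhd.exists_tangential (hρ : ρ ≤ T.δ)
    (hK : ∀ p ∉ range ι, ContMDiffAt 𝓘(ℝ, E) 𝓘(ℝ, ℝ) ∞ K p) (hk : IsLocallyConstant k)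
    (hlin : ∀ r ∈ Ioo (-ρ) ρ, r ≠ 0 → ∀ s, T.pullD K (r, s) (r ^ n, 0) = k s)
    (hnear : ∀ p ∈ range ι, ∃ U : Set M, IsOpen U ∧ p ∈ U ∧ ∃ (a : ℝ → ℝ) (h : M → ℝ),
      ContMDiffOn 𝓘(ℝ, E) 𝓘(ℝ, ℝ) ∞ h U ∧ ∀ q ∈ U, q ∉ range ι → K q = a (z q) + h q)
    (s : S) (w : F) {r r₁ : ℝ} (hr : r ∈ Ioo (-ρ) ρ) (h0 : r ≠ 0) (hr₁ : r₁ ∈ Ioo (-ρ) ρ)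
    (h₁0 : r₁ ≠ 0) : T.pullD K (r, s) (0, w) = T.pullD K (r₁, s) (0, w) := by
  have hρ0 : 0 < ρ := by linarith [hr.1, hr.2]
  have hIT : Ioo (-ρ) ρ ⊆ Ioo (-T.δ) T.δ := Ioo_subset_Ioo (by linarith) hρ
  have hp : T.Ψ (0, s) ∈ range ι := (T.Ψ_mem_range_iff T.zero_mem s).2 rfl
  obtain ⟨U, hU, hpU, a, h, hh, hKU⟩ := hnear _ hp
  have hhs : ∀ q ∈ U, ContMDiffAt 𝓘(ℝ, E) 𝓘(ℝ, ℝ) ∞ h q := fun q hq =>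
    hh.contMDiffAt (hU.mem_nhds hq)
  have hc : ContinuousAt (fun r => T.Ψ (r, s)) 0 :=
    ContinuousAt.comp (f := fun r : ℝ => (r, s)) (T.contMDiffAt_Ψ (q := (0, s))
      T.zero_mem).continuousAt (by fun_prop)
  have hlim : Filter.Tendsto (fun r => T.pullD h (r, s) (0, w)) (𝓝 0)
      (𝓝 (T.pullD h (0, s) (0, w))) := by
    have h1 : ContDiffAt ℝ ∞ (h ∘ T.coord s) (0, extChartAt 𝓘(ℝ, F) s s) := by
      rw [← contMDiffAt_iff_contDiffAt]
      refine ContMDiffAt.comp _ ?_ (T.contMDiffAt_coord (T.mem_coordDomain T.zero_mem s))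
      rw [T.coord_self]
      exact hhs _ hpU
    have h2 : ContinuousAt (fun y => fderiv ℝ (h ∘ T.coord s) y (0, w))
        (0, extChartAt 𝓘(ℝ, F) s s) :=
      ((h1.fderiv_right (m := ∞) (by simp)).clm_apply contDiffAt_const).continuousAt
    have h3 := ContinuousAt.comp (f := fun r : ℝ => (r, extChartAt 𝓘(ℝ, F) s s)) (x := 0) h2
      (by fun_prop)
    refine ContinuousAt.tendsto (h3.congr ?_)
    filter_upwards [hc.eventually_mem (hU.mem_nhds hpU), isOpen_Ioo.mem_nhds T.zero_mem] with
      r hrU hr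
    have h4 := (T.hasFDerivAt_coord (T.mem_coordDomain hr s) (K := h) (by
      rw [T.coord_self]
      exact (hhs _ hrU).mdifferentiableAt (by simp))).fderiv
    rw [dChartSymm_self, extChartAt_to_inv] at h4
    rw [Function.comp_apply, h4]
    rfl
  have heq : ∀ᶠ r in 𝓝[≠] (0 : ℝ), T.pullD K (r, s) (0, w) = T.pullD h (r, s) (0, w) := by
    filter_upwards [self_mem_nhdsWithin, nhdsWithin_le_nhds (hc.eventually_mem (hU.mem_nhds hpU)),
      nhdsWithin_le_nhds (isOpen_Ioo.mem_nhds T.zero_mem)] with r hr0 hrU hr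
    have hd := T.mem_coordDomain hr s
    have hrZ : T.Ψ (r, s) ∉ range ι := by rwa [T.Ψ_mem_range_iff hr]
    have h1 := T.hasFDerivAt_slice hd (K := K) (by
      rw [T.coord_self]
      exact (hK _ hrZ).mdifferentiableAt (by simp))
    have h2 := T.hasFDerivAt_slice hd (K := h) (by
      rw [T.coord_self]
      exact (hhs _ hrU).mdifferentiableAt (by simp))
    have hct : ContinuousAt (fun x => T.coord s (r, x)) (extChartAt 𝓘(ℝ, F) s s) :=
      ContinuousAt.comp (f := fun x : F => (r, x)) (T.contMDiffAt_coord hd).continuousAt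
        (by fun_prop)
    -- On a slice `z` is constant, so the singular part contributes only the constant `a r`; the
    -- tangential derivative sees `h` alone.
    have hev : (fun x => K (T.coord s (r, x))) =ᶠ[𝓝 (extChartAt 𝓘(ℝ, F) s s)]
        fun x => a r + h (T.coord s (r, x)) := by
      filter_upwards [hct.eventually_mem (hU.mem_nhds (by rwa [T.coord_self]))] with x hx
      have h3 := hKU _ hx (by rwa [TubularNhd.coord, T.Ψ_mem_range_iff hr])
      rw [h3, TubularNhd.coord, T.z_Ψ r hr]
    have h3 := (h1.congr_of_eventuallyEq hev.symm).unique (h2.const_add (a r))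
    rw [dChartSymm_self, extChartAt_to_inv] at h3
    exact DFunLike.congr_fun h3 w
  have hlimK : Filter.Tendsto (fun r => T.pullD K (r, s) (0, w)) (𝓝[≠] 0)
      (𝓝 (T.pullD h (0, s) (0, w))) :=
    (hlim.mono_left nhdsWithin_le_nhds).congr' (heq.mono fun _ h => h.symm)
  -- A function constant on one side equals its limit at `Z`. Both one-sided limits are the
  -- derivative of the smooth `h` at `Z`, which links the two sides.
  have key : ∀ r ∈ Ioo (-ρ) ρ, r ≠ 0 → T.pullD K (r, s) (0, w) = T.pullD h (0, s) (0, w) := by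
    intro r hr h0
    rcases lt_or_gt_of_ne h0 with hneg | hpos
    · have hsub : Ioo (-ρ) 0 ⊆ Ioo (-ρ) ρ := Ioo_subset_Ioo le_rfl hρ0.le
      have hlim' := hlimK.mono_left (nhdsWithin_mono (0 : ℝ) (s := Iio 0) fun x hx => ne_of_lt hx)
      refine tendsto_nhds_unique (tendsto_const_nhds.congr' ?_) hlim'
      filter_upwards [Ioo_mem_nhdsLT (show -ρ < 0 by linarith)] with r' hr'
      exact T.tangential_eq_of_same_side isOpen_Ioo isPreconnected_Ioo (hsub.trans hIT)
        (fun h => lt_irrefl _ h.2) hK hk (fun x hx => hlin x (hsub hx) hx.2.ne) ⟨hr.1, hneg⟩ hr' s w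
    · have hsub : Ioo 0 ρ ⊆ Ioo (-ρ) ρ := Ioo_subset_Ioo (by linarith) le_rfl
      have hlim' := hlimK.mono_left (nhdsWithin_mono (0 : ℝ) (s := Ioi 0) fun x hx => ne_of_gt hx)
      refine tendsto_nhds_unique (tendsto_const_nhds.congr' ?_) hlim'
      filter_upwards [Ioo_mem_nhdsGT hρ0] with r' hr'
      exact T.tangential_eq_of_same_side isOpen_Ioo isPreconnected_Ioo (hsub.trans hIT)
        (fun h => lt_irrefl _ h.1) hK hk (fun x hx => hlin x (hsub hx) hx.1.ne') ⟨hpos, hr.2⟩ hr' s w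
  rw [key r hr h0, key r₁ hr₁ h₁0]

end Invariance

/-! ### Existence and uniqueness of the Hamiltonian field -/

section Existence

variable {F : Type*} [NormedAddCommGroup F] [NormedSpace ℝ F]
  {S : Type*} [TopologicalSpace S] [ChartedSpace F S]
  [IsManifold 𝓘(ℝ, F) ∞ S] [FiniteDimensional ℝ F]
  {E : Type*} [NormedAddCommGroup E] [NormedSpace ℝ E] [FiniteDimensional ℝ E]
  {M : Type*} [TopologicalSpace M] [ChartedSpace E M] [IsManifold 𝓘(ℝ, E) ∞ M]
  {ι : S → M} {z : M → ℝ} {T : TubularNhd E F ι z}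
  {m : ℕ} {Ω : DiffForm E M 2} {α : ℕ → DiffForm F S 1} {β : DiffForm F S 2}
  {f : ℝ → ℝ} {ε ρ : ℝ} {K : M → ℝ} {k : S → ℝ} {X : VField E M}

omit [IsManifold 𝓘(ℝ, E) ∞ M] [IsManifold 𝓘(ℝ, F) ∞ S] [FiniteDimensional ℝ E]
  [FiniteDimensional ℝ F] in
theorem TubularNhd.pullD_apply {r : ℝ} {s : S} (u : ℝ × F) {n : ℕ} (h0 : r ≠ 0) {c : ℝ}
    (hc : T.pullD K (r, s) (r ^ n, 0) = c) :
    T.pullD K (r, s) u = u.1 * ((r ^ n)⁻¹ * c) + T.pullD K (r, s) (0, u.2) := by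
  have h1 : u = (u.1 * (r ^ n)⁻¹) • (r ^ n, (0 : F)) + (0, u.2) := by
    ext <;> simp [h0]
  conv_lhs => rw [h1]
  rw [map_add, map_smul, hc, smul_eq_mul, mul_assoc]

/-- The Hamiltonian vector field of an admissible function. Along the tubular neighbourhood it is
tangent to the level sets of `z`, and its contraction with the desingularized form is exact
there. -/
theorem exists_hamiltonian (hm : 1 ≤ m)
    (hz : IsLocalDefiningFunction E (range ι) z) (hΩ : IsBSymplectic (2 * m) (range ι) z Ω)
    (hT : IsDecomposition T (2 * m) Ω α β) (hf : IsDesingFunction m f) (hε : 0 < ε)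
    (hεT : ε ≤ T.δ) (hρT : ρ ≤ T.δ)
    (hlin : ∀ r ∈ Ioo (-ρ) ρ, r ≠ 0 → ∀ s, T.pullD K (r, s) (r ^ (2 * m), 0) = k s)
    (g : S → F →L[ℝ] ℝ)
    (htan : ∀ r ∈ Ioo (-ρ) ρ, r ≠ 0 → ∀ s w, T.pullD K (r, s) (0, w) = g s w)
    (hreeb : ∀ s R, IsReebAt (α 0) β s R → g s R = 0) :
    ∃ X : VField E M,
      (∀ p ∉ range ι, ∀ v : TangentSpace 𝓘(ℝ, E) p, Ω p ![X p, v] = - dAt K p v) ∧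
      (∀ r ∈ Ioo (-ρ) ρ, ∀ s, ∃ w, X.fiber (T.Ψ (r, s)) = T.dΨ (r, s) (0, w)) ∧
      ∀ r ∈ Ioo (-ρ) ρ, ∀ s v, (desing T m Ω α β f ε).fiber (T.Ψ (r, s))
          ![X.fiber (T.Ψ (r, s)), T.dΨ (r, s) v] =
        - (v.1 * (deriv (fEps m f ε) r * k s) + g s v.2) := by
  have hIT : Ioo (-ρ) ρ ⊆ Ioo (-T.δ) T.δ := Ioo_subset_Ioo (by linarith) hρT
  have hφ : ∀ r, deriv (fEps m f ε) r ≠ 0 := fun r => (hf.deriv_fEps_pos hm hε r).ne'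
  -- The vector is found with the regular coefficient `f_ε'`, so `r = 0` is included. The last two
  -- equations, free of `φ`, are what make it a solution for `Ω` as well.
  have hsol : ∀ r ∈ Ioo (-ρ) ρ, ∀ s, ∃ w : F, (∀ v : ℝ × F,
      modelForm (2 * m) α β (deriv (fEps m f ε)) (r, s) ![(0, w), v] =
        - (v.1 * (deriv (fEps m f ε) r * k s) + g s v.2)) ∧
      coeff (2 * m) α r s w = k s ∧ ∀ v, β.fiber s ![w, v] = - g s v := by
    intro r hr s
    have hND := modelNondeg T (by omega) hz hΩ hT (hIT hr) s
    obtain ⟨R, hR⟩ := exists_reeb (by omega)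
      (modelNondeg T (by omega) hz hΩ hT T.zero_mem s)
    obtain ⟨u, hu⟩ := (pairing_isInvertible ((modelNondeg_iff (hφ r)).1 hND)).surjective
      (-((deriv (fEps m f ε) r * k s) • ContinuousLinearMap.fst ℝ ℝ F +
        (g s).comp (ContinuousLinearMap.snd ℝ ℝ F)))
    have hu' : ∀ v : ℝ × F, modelForm (2 * m) α β (deriv (fEps m f ε)) (r, s) ![u, v] =
        - (v.1 * (deriv (fEps m f ε) r * k s) + g s v.2) := by
      intro v
      rw [← pairing_apply, hu]
      simp [mul_comm]
    obtain ⟨h1, h2, h3⟩ := modelForm_hamiltonian (hφ r) hND hR (hreeb s R hR) hu'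
    have h4 : u = (0, u.2) := Prod.ext h1 rfl
    exact ⟨u.2, by rwa [h4] at hu', h2, h3⟩
  have hex : ∀ p : M, ∃ x : E,
      (p ∉ range ι → ∀ v : E, Ω.fiber p ![x, v] = - (dAt (E := E) K p : E →L[ℝ] ℝ) v) ∧
      ∀ r ∈ Ioo (-ρ) ρ, ∀ s, T.Ψ (r, s) = p → (∃ w, x = T.dΨ (r, s) (0, w)) ∧
        ∀ v, (desing T m Ω α β f ε).fiber p ![x, T.dΨ (r, s) v] =
          - (v.1 * (deriv (fEps m f ε) r * k s) + g s v.2) := by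
    intro p
    by_cases hp : p ∈ T.nhd ρ
    · obtain ⟨⟨r, s⟩, ⟨hr, -⟩, rfl⟩ := hp
      obtain ⟨w, hw, hc, hβ⟩ := hsol r hr s
      refine ⟨T.dΨ (r, s) (0, w), fun hp v => ?_, fun r' hr' s' h => ?_⟩
      · have h0 : r ≠ 0 := fun h => hp ((T.Ψ_mem_range_iff (hIT hr) s).2 h)
        obtain ⟨v, rfl⟩ := (T.dΨ_isInvertible (q := (r, s)) (hIT hr)).surjective v
        have h1 := hT.apply T (hIT hr) h0 s (0, w) v
        rw [modelForm_apply] at h1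
        have h2 : (dAt (E := E) K (T.Ψ (r, s)) : E →L[ℝ] ℝ) (T.dΨ (r, s) v) = _ :=
          T.pullD_apply v h0 (hlin r hr h0 s)
        rw [h1, h2, htan r hr h0 s, hβ, hc]
        ring
      · have h' := T.injOn (x₁ := (r', s')) ⟨hIT hr', mem_univ _⟩ (x₂ := (r, s))
          ⟨hIT hr, mem_univ _⟩ h
        obtain ⟨rfl, rfl⟩ := Prod.ext_iff.1 h'
        exact ⟨⟨w, rfl⟩, fun v =>
          (desing_apply T hm hT hf hε hεT (hIT hr) s' (0, w) v).trans (hw v)⟩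
    · by_cases hpZ : p ∈ range ι
      -- An arbitrary value: nothing is required at a point of `Z` outside the `ρ`-tube, and there
      -- is no such point when `ρ > 0`.
      · obtain ⟨x, hx⟩ : ∃ x : E, x = 0 := ⟨0, rfl⟩
        exact ⟨x, fun h => (h hpZ).elim, fun r hr s h => (hp ⟨(r, s), ⟨hr, mem_univ _⟩, h⟩).elim⟩
      · obtain ⟨x, hx⟩ := (pairing_isInvertible (a := Ω.fiber p) (hΩ.nondeg p hpZ)).surjective
          (-(dAt (E := E) K p : E →L[ℝ] ℝ))
        exact ⟨x, fun _ v => (pairing_apply _ _ _).symm.trans (DFunLike.congr_fun hx v),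
          fun r hr s h => (hp ⟨(r, s), ⟨hr, mem_univ _⟩, h⟩).elim⟩
  choose X hX1 hX2 using hex
  exact ⟨X, hX1, fun r hr s => (hX2 _ r hr s rfl).1, fun r hr s => (hX2 _ r hr s rfl).2⟩

omit [FiniteDimensional ℝ E] in
/-- The Hamiltonian vector field of an admissible function is locally Hamiltonian for the
desingularized form. -/
theorem isLocallyHamiltonianAt_desing [T2Space M] [CompactSpace S]
    (hρ : 0 < ρ) (hf : IsDesingFunction m f) (hεT : ε < T.δ) (hερ : ε < ρ) (hε : 0 < ε)
    (hρT : ρ ≤ T.δ)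
    (hK : ∀ p ∉ range ι, ContMDiffAt 𝓘(ℝ, E) 𝓘(ℝ, ℝ) ∞ K p) (hk : IsLocallyConstant k)
    (hX : ∀ p ∉ range ι, ∀ v : TangentSpace 𝓘(ℝ, E) p, Ω p ![X p, v] = - dAt K p v)
    (hX' : ∀ r ∈ Ioo (-ρ) ρ, ∀ s v, (desing T m Ω α β f ε).fiber (T.Ψ (r, s))
          ![X.fiber (T.Ψ (r, s)), T.dΨ (r, s) v] =
        - (v.1 * (deriv (fEps m f ε) r * k s) + T.pullD K (ρ / 2, s) (0, v.2))) (p : M) :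
    IsLocallyHamiltonianAt (desing T m Ω α β f ε) X p := by
  have hIT : Ioo (-ρ) ρ ⊆ Ioo (-T.δ) T.δ := Ioo_subset_Ioo (by linarith) hρT
  have hr₁ : ρ / 2 ∈ Ioo (-T.δ) T.δ := hIT ⟨by linarith, by linarith⟩
  have hne : ∀ s, T.Ψ (ρ / 2, s) ∉ range ι := fun s => by
    rw [T.Ψ_mem_range_iff hr₁]
    exact (half_pos hρ).ne'
  by_cases hp : p ∈ T.nhd ρ
  · obtain ⟨⟨r₀, s₀⟩, ⟨hr₀, -⟩, rfl⟩ := hp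
    have hd : ∀ y ∈ T.coordDomain s₀, (ρ / 2, y.2) ∈ T.coordDomain s₀ := fun y hy => ⟨hr₁, hy.2⟩
    have hG : ∀ y ∈ T.coordDomain s₀,
        ContDiffAt ℝ ∞ (fun x => K (T.coord s₀ (ρ / 2, x))) y.2 := by
      intro y hy
      rw [← contMDiffAt_iff_contDiffAt]
      refine ContMDiffAt.comp y.2 (hK _ (hne _)) ((T.contMDiffAt_coord (hd y hy)).comp
        (f := fun x : F => (ρ / 2, x)) y.2 ?_)
      rw [contMDiffAt_iff_contDiffAt]
      fun_prop
    have hφ := hf.contDiff_fEps ε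
    -- The primitive replaces the singular antiderivative of `k r^{-2m}` by `k f_ε`. The slice `r =
    -- ρ/2` is only a reference level off `Z`, on which `K` is smooth and has the tangential
    -- differential common to all levels.
    refine T.isLocallyHamiltonianAt_of_coord _ X (hIT hr₀)
      (κ := fun y => k s₀ * fEps m f ε y.1 + K (T.coord s₀ (ρ / 2, y.2))) ?_ ?_
    · refine ContDiffAt.add (contDiffAt_const.mul (hφ.contDiffAt.comp _ contDiffAt_fst)) ?_
      exact ContDiffAt.comp (f := Prod.snd) _ (hG _ (T.mem_coordDomain (hIT hr₀) s₀)) contDiffAt_snd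
    · have hc := (contMDiffAt_chartSymm
        (mem_extChartAt_target (I := 𝓘(ℝ, F)) s₀)).continuousAt.tendsto
      rw [extChartAt_to_inv] at hc
      have hk' := (hc.comp (continuous_snd.tendsto
        (r₀, extChartAt 𝓘(ℝ, F) s₀ s₀))).eventually (hk.eventually_eq s₀)
      filter_upwards [hk', (T.isOpen_coordDomain s₀).mem_nhds (T.mem_coordDomain (hIT hr₀) s₀),
        (isOpen_Ioo.preimage continuous_fst).mem_nhds hr₀] with y hky hy hyρ u
      have hky' : k ((extChartAt 𝓘(ℝ, F) s₀).symm y.2) = k s₀ := hky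
      have h1 : HasFDerivAt (fun y : ℝ × F => fEps m f ε y.1) _ y :=
        ((hφ.differentiable (by simp)) y.1).hasDerivAt.comp_hasFDerivAt y
          (hasFDerivAt_fst (𝕜 := ℝ) (E := ℝ) (F := F) (p := y))
      have h2 : HasFDerivAt (fun y : ℝ × F => K (T.coord s₀ (ρ / 2, y.2))) _ y :=
        (T.hasFDerivAt_slice (hd y hy) ((hK _ (hne _)).mdifferentiableAt (by simp))).comp y
          hasFDerivAt_snd
      rw [((h1.const_mul (k s₀)).fun_add h2).fderiv, T.dCoord_apply]
      refine (hX' y.1 hyρ _ _).trans ?_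
      rw [hky']
      simp
      ring
  -- Since `ε < ρ`, a point outside the `ρ`-tube has a neighbourhood where the form is still `Ω`,
  -- and `K` itself is the Hamiltonian.
  · have hpt : p ∈ (T.Ψ '' (Icc (-ε) ε ×ˢ univ))ᶜ := by
      rintro ⟨q, ⟨hq, -⟩, rfl⟩
      exact hp ⟨q, ⟨⟨by linarith [hq.1], by linarith [hq.2]⟩, mem_univ _⟩, rfl⟩
    have hU : ∀ q ∈ (T.Ψ '' (Icc (-ε) ε ×ˢ univ))ᶜ, q ∉ range ι := fun q hq h =>
      hq (T.range_subset hε h)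
    refine isLocallyHamiltonianAt_of_function (T.isClosed_image hεT).isOpen_compl hpt (K := K)
      (fun q hq => (hK q (hU q hq)).contMDiffWithinAt) fun q hq v => ?_
    rw [desing_of_notMem T fun h => hq (image_mono (prod_mono Ioo_subset_Icc_self subset_rfl) h)]
    exact hX q (hU q hq) v

omit [IsManifold 𝓘(ℝ, F) ∞ S] [FiniteDimensional ℝ F] [FiniteDimensional ℝ E] in
/-- A smooth vector field is determined by its values off `Z`. -/
theorem eq_of_eq_off_range {X Y : VField E M} (hX : SmoothVF X) (hY : SmoothVF Y)
    (T : TubularNhd E F ι z) (h : ∀ p ∉ range ι, X p = Y p) : X = Y := by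
  funext p
  by_cases hp : p ∈ range ι
  swap
  · exact h p hp
  obtain ⟨s, rfl⟩ := hp
  rw [← T.zero_section]
  have hc : Filter.Tendsto (fun r => T.Ψ (r, s)) (𝓝[≠] 0) (𝓝 (T.Ψ (0, s))) :=
    (ContinuousAt.comp (f := fun r : ℝ => (r, s)) (T.contMDiffAt_Ψ (q := (0, s))
      T.zero_mem).continuousAt (by fun_prop)).tendsto.mono_left nhdsWithin_le_nhds
  -- A trivialization near the point of `Z` places the values along `r ↦ Ψ(r, s)` in one vector
  -- space, so that limits can be compared.
  let e := trivializationAt E (TangentSpace 𝓘(ℝ, E) : M → Type _) (T.Ψ (0, s))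
  have hcont : ∀ W : VField E M, SmoothVF W → Filter.Tendsto (fun q => (e ⟨q, W q⟩).2)
      (𝓝 (T.Ψ (0, s))) (𝓝 (e ⟨T.Ψ (0, s), W (T.Ψ (0, s))⟩).2) := fun W hW =>
    ((Bundle.contMDiffAt_section _).1 (hW (T.Ψ (0, s)))).continuousAt.tendsto
  have h1 := (hcont X hX).comp hc
  have h2 := (hcont Y hY).comp hc
  have h3 := tendsto_nhds_unique (h1.congr' ?_) h2
  · have hmem : T.Ψ (0, s) ∈ e.baseSet := mem_baseSet_trivializationAt E _ _
    have h4 := (e.continuousLinearEquivAt ℝ _ hmem).injective (a₁ := X (T.Ψ (0, s)))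
      (a₂ := Y (T.Ψ (0, s))) h3
    exact h4
  · filter_upwards [self_mem_nhdsWithin, nhdsWithin_le_nhds (isOpen_Ioo.mem_nhds T.zero_mem)] with
      r hr0 hr
    have hrZ : T.Ψ (r, s) ∉ range ι := by rwa [T.Ψ_mem_range_iff hr]
    simp only [Function.comp_apply]
    rw [h _ hrZ]

end Existence

end BSymp

end

/-! ### Assembly of the theorem -/

open BSymp in
theorem mainTheorem7
    {E F : Type*} [NormedAddCommGroup E] [NormedSpace ℝ E] [FiniteDimensional ℝ E]
    [NormedAddCommGroup F] [NormedSpace ℝ F] [FiniteDimensional ℝ F]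
    {M : Type*} [TopologicalSpace M] [T2Space M] [CompactSpace M] [ChartedSpace E M]
    [IsManifold 𝓘(ℝ, E) ∞ M]
    {S : Type*} [TopologicalSpace S] [CompactSpace S] [ChartedSpace F S]
    [IsManifold 𝓘(ℝ, F) ∞ S]
    (n m : ℕ) (hm : 1 ≤ m)
    (hE : Module.finrank ℝ E = 2 * n) (hF : Module.finrank ℝ F + 1 = 2 * n)
    (ι : S → M) (hι : IsSmoothEmbedding 𝓘(ℝ, F) 𝓘(ℝ, E) ∞ ι)
    (z : M → ℝ) (hz : BSymp.IsLocalDefiningFunction E (range ι) z)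
    (Ω : BSymp.DiffForm E M 2) (hΩ : BSymp.IsBSymplectic (2 * m) (range ι) z Ω)
    (T : BSymp.TubularNhd E F ι z)
    (α : ℕ → BSymp.DiffForm F S 1) (β : BSymp.DiffForm F S 2)
    (hT : BSymp.IsDecomposition T (2 * m) Ω α β)
    (ρ : ℝ) (hρ : 0 < ρ) (hρT : ρ ≤ T.δ)
    (H : ℝ → M → ℝ) (hH : BSymp.IsAdmissible T (2 * m) Ω α β ρ H)
    (f : ℝ → ℝ) (hf : BSymp.IsDesingFunction m f)
    (ε : ℝ) (hε : 0 < ε) (hερ : ε < ρ) :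
    BSymp.IsSymplecticForm (BSymp.desing T m Ω α β f ε) ∧
    (∃! X : ℝ → BSymp.VField E M, BSymp.IsHamiltonianVF (2 * m) (range ι) z Ω H X) ∧
    ∀ X : ℝ → BSymp.VField E M, BSymp.IsHamiltonianVF (2 * m) (range ι) z Ω H X →
      ∀ t, BSymp.IsSymplecticVF (BSymp.desing T m Ω α β f ε) (X t) := by
  have hεT : ε < T.δ := hερ.trans_le hρT
  have hZ : IsClosed (range ι) :=
    (isCompact_range hι.isEmbedding.continuous).isClosed
  have hIT : Ioo (-ρ) ρ ⊆ Ioo (-T.δ) T.δ := Ioo_subset_Ioo (by linarith) hρT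
  have hsymp := isSymplecticForm_desing hm hz hΩ hT hf hε hεT
  obtain ⟨k, hk, -, -, hlin⟩ := hH.linear
  have hK : ∀ t, ∀ p ∉ range ι, ContMDiffAt 𝓘(ℝ, E) 𝓘(ℝ, ℝ) ∞ (H t) p := by
    intro t p hp
    have h1 := hH.isBFunction.smooth.contMDiffAt (x := (t, p))
      ((isOpen_univ.prod hZ.isOpen_compl).mem_nhds ⟨mem_univ _, hp⟩)
    exact h1.comp p (contMDiffAt_const.prodMk contMDiffAt_id)
  have htan : ∀ t, ∀ r ∈ Ioo (-ρ) ρ, r ≠ 0 → ∀ s w,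
      T.pullD (H t) (r, s) (0, w) = T.pullD (H t) (ρ / 2, s) (0, w) := by
    intro t r hr h0 s w
    refine T.exists_tangential hρT (hK t) (hk t) (hlin t) (fun p hp => ?_) s w hr h0
      ⟨by linarith, by linarith⟩ (half_pos hρ).ne'
    obtain ⟨U, hU, hpU, a, c, h, -, -, -, -, hh, -, hHU⟩ := hH.isBFunction.near p hp
    -- The polar and logarithmic terms form a function of `z` alone once `t` is fixed.
    refine ⟨U, hU, hpU, fun x => ∑ i ∈ Finset.Icc 1 (2 * m - 1), a i t x / x ^ i +
      c t * Real.log |x|, h t, fun q hq => ?_, hHU t⟩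
    have h1 := hh.contMDiffAt (x := (t, q)) ((isOpen_univ.prod hU).mem_nhds ⟨mem_univ _, hq⟩)
    exact (h1.comp q (contMDiffAt_const.prodMk contMDiffAt_id)).contMDiffWithinAt
  have hex : ∀ t, ∃ X : VField E M,
      (∀ p ∉ range ι, ∀ v : TangentSpace 𝓘(ℝ, E) p, Ω p ![X p, v] = - dAt (H t) p v) ∧
      IsBVectorField (2 * m) (range ι) z X ∧ IsSymplecticVF (desing T m Ω α β f ε) X := by
    intro t
    obtain ⟨X, hX1, hX2, hX3⟩ := exists_hamiltonian (ρ := ρ) (K := H t) (k := fun s => k s t) hm hz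
      hΩ hT hf hε hεT.le hρT (hlin t)
      (fun s => (T.pullD (H t) (ρ / 2, s)).comp (ContinuousLinearMap.inr ℝ ℝ F)) (htan t)
      (fun s R hR => hH.reeb t (ρ / 2) ⟨by linarith, by linarith⟩ (half_pos hρ).ne' s R hR)
    have hloc := isLocallyHamiltonianAt_desing hρ hf hεT hερ hε hρT (hK t) (hk t) hX1 hX3
    have hsm : SmoothVF X := fun p =>
      contMDiffAt_of_chartRepVF ((hloc p).contDiffAt (hsymp.smooth p) (hsymp.nondeg p))
    refine ⟨X, hX1, ⟨hsm, fun p hp => ?_⟩, hsm, fun p v =>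
      (hloc p).lieD_eq_zero (hsymp.smooth p) (hsymp.nondeg p) (hsymp.closed p) v⟩
    obtain ⟨Uz, hUz, hZU, hzs, -, -⟩ := hz
    obtain ⟨s, rfl⟩ := hp
    -- The quotient `dz(X) / z^{2m}` can be taken to be `0`, because `X` is tangent to the levels of
    -- `z` in the `ρ`-tube.
    refine ⟨T.nhd ρ ∩ Uz, (T.isOpen_nhd hρT).inter hUz, ⟨?_, hZU ⟨s, rfl⟩⟩, fun _ => 0,
      contMDiffOn_const, ?_⟩
    · rw [← T.zero_section, T.mem_nhd_iff T.zero_mem hρT]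
      exact ⟨by linarith, hρ⟩
    · rintro _ ⟨⟨⟨r, s⟩, ⟨hr, -⟩, rfl⟩, hq⟩
      obtain ⟨w, hw⟩ := hX2 r hr s
      rw [mul_zero]
      have h1 := T.dAt_z (hIT hr)
        ((hzs.contMDiffAt (hUz.mem_nhds hq)).mdifferentiableAt (by simp)) (0, w)
      rw [← hw] at h1
      exact h1
  have huniq : ∀ X Y, IsHamiltonianVF (2 * m) (range ι) z Ω H X →
      IsHamiltonianVF (2 * m) (range ι) z Ω H Y → X = Y := by
    intro X Y hX hY
    funext t
    refine eq_of_eq_off_range (hX t).1.1 (hY t).1.1 T fun p hp => ?_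
    refine (pairing_isInvertible (a := Ω.fiber p) (hΩ.nondeg p hp)).injective
      (ContinuousLinearMap.ext fun v => ?_)
    exact (pairing_apply (Ω.fiber p) ((X t).fiber p) v).trans ((((hX t).2 p hp v).trans
      ((hY t).2 p hp v).symm).trans (pairing_apply (Ω.fiber p) ((Y t).fiber p) v).symm)
  choose X hX1 hX2 hX3 using hex
  have hX : IsHamiltonianVF (2 * m) (range ι) z Ω H X := fun t => ⟨hX2 t, hX1 t⟩
  refine ⟨hsymp, ⟨X, hX, fun Y hY => huniq Y X hY hX⟩, fun Y hY t => ?_⟩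
  rw [huniq Y X hY hX]
  exact hX3 t
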